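/- **Setting.** Let $\langle\xi\rangle=\max(1,|\xi|)$. For $s\in\mathbb R$ let $H^s=H^s(\mathbb T,\mathbb C)$, $\mathbb T=\mathbb R/2\pi\mathbb Z$, be the space of $u=\sum_{k\in\mathbb Z}u_ke^{ikx}$ with $\|u\|_s^2=\sum_k\langle k\rangle^{2s}|u_k|^2<\infty$, and let $\langle u,v\rangle=\frac1{2\pi}\int_{\mathbb T}u\bar v\,dx=\sum_k u_k\overline{v_k}$ (extended to $H^{-s}\times H^s$). Fix $0<\delta_0\le\frac1{10}$ and a cut-off $\chi\in C^\infty(\mathbb R\times\mathbb R;\mathbb R)$, even in each argument, with $\operatorname{supp}\chi\subset\{|\xi'|\le\delta_0\langle\xi\rangle\}$, $\chi(\xi',\xi)=1$ for $|\xi'|\le\delta_0\langle\xi\rangle/2$, and $|\partial_\xi^\ell\partial_{\xi'}^\beta\chi(\xi',\xi)|\le C_{\ell,\beta}\langle\xi\rangle^{-\ell-\beta}$ for all $\ell,\beta\in\mathbb N_0$. The Bony–Weyl quantization of a symbol $a(x,\xi)$, $2\pi$-periodic in $x$, is $$\mathrm{Op}^{BW}(a)u=\sum_{k\in\mathbb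 Z}\Big(\sum_{j\in\mathbb Z}\chi\big(k-j,\tfrac{k+j}2\big)\,\hat a\big(k-j,\tfrac{k+j}2\big)\,u_j\Big)e^{ikx},\qquad \hat a(n,\xi)=\frac1{2\pi}\int_0^{2\pi}a(x,\xi)e^{-inx}\,dx .$$ For operators, $\mathfrak A\ge\mathfrak B$ means that $\langle\mathfrak Au,u\rangle$ and $\langle\mathfrak Bu,u\rangle$ are real and $\langle\mathfrak Au,u\rangle\ge\langle\mathfrak Bu,u\rangle$ for all $u\in\bigcap_{r}H^r$. For $z_1,z_{-1}\in\mathbb C$ (written $z_1(0),z_{-1}(0)$ in the application) put $$J_1=\frac{|z_1|^2+|z_{-1}|^2}2,\quad \mathfrak v(x)=2\,\mathrm{Re}\big(z_1\overline{z_{-1}}e^{2ix}\big),\quad \mathtt a(x)=-\mathrm{Im}\big(z_1\overline{z_{-1}}e^{2ix}\big),$$ $$I_1=2|z_1||z_{-1}|\Big(2|z_1||z_{-1}|-\frac{|z_1|^2+|z_{-1}|^2}2\Big).$$ Let $\eta(y)=0$ for $y\le1$, $\eta(y)=\dfrac{e^{-1/(y-1)}}{e^{-1/(y-1)}+e^{-1/(2-y)}}$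 for $1<y<2$, $\eta(y)=1$ for $y\ge2$, let $\eta_R(\xi)=\eta(\xi/R)$, and let $\mathfrak A=\mathrm{Op}^{BW}\big(\mathtt a(x)|\xi|^{2s}\eta_R^2(\xi)\big)$. **Lemma.** For every $s>1$ there is a constant $C_s>0$, depending only on $s$ (and on the fixed cut-off $\chi$), such that for all $R>1$ and all $z_1,z_{-1}\in\mathbb C$ the following hold. (i) **Positive commutator.** There is a linear operator $\mathfrak R\colon H^s\to H^{-s}$ with $$i\big[\mathfrak A,\mathrm{Op}^{BW}\big((J_1+\mathfrak v(x))\xi\big)\big]\ \ge\ I_1\,\mathrm{Op}^{BW}\big(|\xi|^{2s}\eta_R^2(\xi)\big)+\mathfrak R,\qquad \|\mathfrak Ru\|_{-s}\le C_s\frac{|z_1|^4+|z_{-1}|^4}{R}\|u\|_s\quad\forall u\in H^s .$$ Moreover $I_1>0$ whenever $J_1+\mathfrak v$ changes sign, that is, takes both negative and positive values. (ii) **Upper bound.** There is a linear operator $\mathfrak R\colon H^s\to H^{-s}$ with $$\mathfrak A\ \le\ 2|z_1||z_{-1}|\,\mathrm{Op}^{BW}\big(|\xi|^{2s}\eta_R^2(\xi)\big)+\mathfrak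 R,\qquad \|\mathfrak Ru\|_{-s}\le C_s\frac{|z_1|^2+|z_{-1}|^2}{R^2}\|u\|_s\quad\forall u\in H^s .$$ -/

import Mathlib

open scoped ContDiff

noncomputable section

namespace ParaMourre

/-! ## Periodic functions and distributions through their Fourier coefficients

A (generalised) function `u(x) = ∑ₖ uₖ e^{ikx}` on the circle `ℝ / 2πℤ` is represented by the family
`u : ℤ → ℂ` of its Fourier coefficients. This covers the distributions in the spaces of negative
order. -/

/-- The bracket `⟨ξ⟩ = max (1, |ξ|)`. -/
def bracket (ξ : ℝ) : ℝ := max 1 |ξ|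

/-- The space `H^s` of the circle, for any real `s`: `∑ₖ ⟨k⟩^{2s} |uₖ|² < ∞`. -/
def Sob (s : ℝ) : Submodule ℂ (ℤ → ℂ) where
  carrier := {u | Summable fun k : ℤ => bracket k ^ (2 * s) * ‖u k‖ ^ 2}
  zero_mem' := by simp [summable_zero]
  add_mem' := by
    intro u v hu hv
    have hb : ∀ k : ℤ, 0 ≤ bracket k ^ (2 * s) := fun k =>
      Real.rpow_nonneg (le_trans zero_le_one (le_max_left _ _)) _
    refine Summable.of_nonneg_of_le (fun k => mul_nonneg (hb k) (sq_nonneg _)) (fun k => ?_)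
      ((hu.add hv).mul_left 2)
    have h1 : ‖(u + v) k‖ ^ 2 ≤ 2 * (‖u k‖ ^ 2 + ‖v k‖ ^ 2) := by
      have h2 : ‖(u + v) k‖ ≤ ‖u k‖ + ‖v k‖ := norm_add_le _ _
      nlinarith [norm_nonneg ((u + v) k), sq_nonneg (‖u k‖ - ‖v k‖)]
    nlinarith [mul_le_mul_of_nonneg_left h1 (hb k)]
  smul_mem' := by
    intro c u hu
    refine (hu.mul_left (‖c‖ ^ 2)).congr (fun k => ?_)
    simp only [Pi.smul_apply, smul_eq_mul, norm_mul]
    ring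

/-- The norm of `H^s`, `‖u‖_s = (∑ₖ ⟨k⟩^{2s} |uₖ|²)^{1/2}`. -/
def sobNorm (s : ℝ) (u : ℤ → ℂ) : ℝ :=
  Real.sqrt (∑' k : ℤ, bracket k ^ (2 * s) * ‖u k‖ ^ 2)

/-- The smooth functions on the circle, `⋂ₛ H^s`. -/
abbrev SobInf : Type := {u : ℤ → ℂ // ∀ r : ℝ, u ∈ Sob r}

/-- The pairing `⟨u, v⟩ = (1/2π) ∫ u v̄ dx`, written in Fourier coefficients so that it extends to
`H^{-s} × H^s`; see `pairing_fourierCoeff`. -/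
def pairing (u v : ℤ → ℂ) : ℂ := ∑' k : ℤ, u k * (starRingEnd ℂ) (v k)

/-- On square-integrable functions, `pairing` is the `L²` scalar product for the normalised
measure `dx / 2π`. -/
theorem pairing_fourierCoeff [Fact (0 < 2 * Real.pi)]
    (f g : MeasureTheory.Lp ℂ 2 (AddCircle.haarAddCircle (T := 2 * Real.pi))) :
    pairing (fourierCoeff f) (fourierCoeff g) =
      ∫ x, f x * (starRingEnd ℂ) (g x) ∂AddCircle.haarAddCircle := by
  have h := (fourierBasis (T := 2 * Real.pi)).tsum_inner_mul_inner g f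
  rw [MeasureTheory.L2.inner_def] at h
  have h1 : ∀ k : ℤ, inner ℂ g (fourierBasis (T := 2 * Real.pi) k) *
      inner ℂ (fourierBasis (T := 2 * Real.pi) k) f =
      fourierCoeff f k * (starRingEnd ℂ) (fourierCoeff g k) := by
    intro k
    rw [← inner_conj_symm, ← HilbertBasis.repr_apply_apply, ← HilbertBasis.repr_apply_apply,
      fourierBasis_repr, fourierBasis_repr, mul_comm]
  simp only [h1] at h
  simpa [pairing, RCLike.inner_apply] using h

/-- The order `A ≤ B` of operators: the numbers `⟨A u, u⟩`, `⟨B u, u⟩` are real and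
`⟨A u, u⟩ ≤ ⟨B u, u⟩`, for every `u ∈ ⋂ₛ H^s`. -/
def OpLE (A B : SobInf → (ℤ → ℂ)) : Prop :=
  ∀ u : SobInf, (pairing (A u) u.1).im = 0 ∧ (pairing (B u) u.1).im = 0 ∧
    (pairing (A u) u.1).re ≤ (pairing (B u) u.1).re

/-! ## Bony-Weyl quantization -/

/-- The admissible cut-off functions `χ(ξ', ξ)` with parameter `δ₀`. -/
structure IsCutoff (δ₀ : ℝ) (χ : ℝ → ℝ → ℝ) : Prop where
  delta_pos : 0 < δ₀
  delta_le : δ₀ ≤ 1 / 10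
  smooth : ContDiff ℝ ∞ (fun p : ℝ × ℝ => χ p.1 p.2)
  even_left : ∀ ξ' ξ : ℝ, χ (-ξ') ξ = χ ξ' ξ
  even_right : ∀ ξ' ξ : ℝ, χ ξ' (-ξ) = χ ξ' ξ
  supp : ∀ ξ' ξ : ℝ, χ ξ' ξ ≠ 0 → |ξ'| ≤ δ₀ * bracket ξ
  eq_one : ∀ ξ' ξ : ℝ, |ξ'| ≤ δ₀ * bracket ξ / 2 → χ ξ' ξ = 1
  deriv_bound : ∀ l b : ℕ, ∃ C : ℝ, ∀ ξ' ξ : ℝ,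
    |iteratedDeriv l (fun y => iteratedDeriv b (fun y' => χ y' y) ξ') ξ| ≤
      C * bracket ξ ^ (-((l : ℝ) + (b : ℝ)))

/-- The `n`-th Fourier coefficient in `x` of the symbol `a(x, ξ)`, which is `2π`-periodic in `x`. -/
def symbolCoeff (a : ℝ → ℝ → ℂ) (n : ℤ) (ξ : ℝ) : ℂ :=
  (1 / (2 * Real.pi) : ℂ) *
    ∫ x in (0 : ℝ)..(2 * Real.pi), a x ξ * Complex.exp (-(Complex.I * (n : ℂ) * (x : ℂ)))

/-- The Bony-Weyl quantization of the symbol `a(x, ξ)` with the cut-off `χ`: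
`(Op^{BW}(a) u)ₖ = ∑ⱼ χ(k - j, (k + j)/2) â(k - j, (k + j)/2) uⱼ`. For a cut-off `χ` as above
the sum over `j` has only finitely many non-zero terms. -/
def OpBW (χ : ℝ → ℝ → ℝ) (a : ℝ → ℝ → ℂ) (u : ℤ → ℂ) : ℤ → ℂ := fun k =>
  ∑' j : ℤ, (χ ((k : ℝ) - (j : ℝ)) (((k : ℝ) + (j : ℝ)) / 2) : ℂ) *
    symbolCoeff a (k - j) (((k : ℝ) + (j : ℝ)) / 2) * u j

/-- The operator `i [A, B]`. -/
def iComm (A B : (ℤ → ℂ) → (ℤ → ℂ)) (u : ℤ → ℂ) : ℤ → ℂ :=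
  Complex.I • (A (B u) - B (A u))

/-! ## The symbols; `z₁` and `z₂` stand for the modes `z_1(0)` and `z_{-1}(0)` -/

/-- `J₁ = (|z_1(0)|² + |z_{-1}(0)|²) / 2`. -/
def J₁ (z₁ z₂ : ℂ) : ℝ := (‖z₁‖ ^ 2 + ‖z₂‖ ^ 2) / 2

/-- `𝔳(x) = 2 Re (z_1(0) conj(z_{-1}(0)) e^{2ix})`. -/
def frakV (z₁ z₂ : ℂ) (x : ℝ) : ℝ :=
  2 * (z₁ * (starRingEnd ℂ) z₂ * Complex.exp (Complex.I * 2 * (x : ℂ))).re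

/-- `a(x) = - Im (z_1(0) conj(z_{-1}(0)) e^{2ix})`. -/
def mourreCoeff (z₁ z₂ : ℂ) (x : ℝ) : ℝ :=
  -(z₁ * (starRingEnd ℂ) z₂ * Complex.exp (Complex.I * 2 * (x : ℂ))).im

/-- `I₁ = 2 |z_1(0)| |z_{-1}(0)| (2 |z_1(0)| |z_{-1}(0)| - (|z_1(0)|² + |z_{-1}(0)|²) / 2)`. -/
def I₁ (z₁ z₂ : ℂ) : ℝ :=
  2 * ‖z₁‖ * ‖z₂‖ * (2 * ‖z₁‖ * ‖z₂‖ - (‖z₁‖ ^ 2 + ‖z₂‖ ^ 2) / 2)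

/-- The smooth step function `η`. -/
def eta (y : ℝ) : ℝ :=
  if y ≤ 1 then 0
  else if y < 2 then
    Real.exp (-(1 / (y - 1))) / (Real.exp (-(1 / (y - 1))) + Real.exp (-(1 / (2 - y))))
  else 1

/-- `η_R(ξ) = η(ξ / R)`. -/
def etaR (R ξ : ℝ) : ℝ := eta (ξ / R)

/-- The multiplier `|ξ|^{2s} η_R(ξ)²`, as a symbol. -/
def multSymbol (s R : ℝ) (_x ξ : ℝ) : ℂ := ((|ξ| ^ (2 * s) * etaR R ξ ^ 2 : ℝ) : ℂ)

/-- The escape function `𝔞(x, ξ) = a(x) |ξ|^{2s} η_R(ξ)²`. -/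
def mourreSymbol (z₁ z₂ : ℂ) (s R : ℝ) (x ξ : ℝ) : ℂ :=
  ((mourreCoeff z₁ z₂ x * |ξ| ^ (2 * s) * etaR R ξ ^ 2 : ℝ) : ℂ)

/-- The transport symbol `(J₁ + 𝔳(x)) ξ`. -/
def transportSymbol (z₁ z₂ : ℂ) (x ξ : ℝ) : ℂ :=
  (((J₁ z₁ z₂ + frakV z₁ z₂ x) * ξ : ℝ) : ℂ)

/-- The operator `𝔄 = Op^{BW}(𝔞)`. -/
def frakA (χ : ℝ → ℝ → ℝ) (z₁ z₂ : ℂ) (s R : ℝ) : (ℤ → ℂ) → (ℤ → ℂ) :=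
  OpBW χ (mourreSymbol z₁ z₂ s R)

end ParaMourre

end

open ParaMourre

namespace ParaMourre

/-! ## Quantization of trigonometric symbols -/

/-! Put $w=z_1\overline{z_{-1}}$ and $W=|w|$. All symbols are trigonometric in $x$ with frequencies
$0,\pm2$, so on Fourier coefficients the operators are banded matrices: $\mathfrak A$ has bands
$\pm2$, and its commutator with the transport operator has a diagonal and the bands $\pm2$, $\pm4$
(`iComm_apply`). A Hermitian pair of bands has a real quadratic form, bounded by the diagonal form
of its absolute row sums (`hasSum_band`). Both estimates thus reduce to scalar inequalities at each
frequency.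

Let $g=|\xi|^{2s}\eta_R^2$, which lives on $\xi>R$, let $S(x)=g(x+1)+g(x-1)$ and let $D$ be
`crossDiff` of $g$. Where the cut-off equals $1$, the diagonal entry is $W^2(D+2S)$, the bands
$\pm4$ cost $\frac{W^2}2(|D(x-2)|+|D(x+2)|)$ and the bands $\pm2$ cost $J_1WS$. Since $g(\xi)/\xi$
is nondecreasing, $D\ge0$; the absolute values disappear and the $D$ terms cancel up to a difference
of size $x^{2s-1}$. What is left is $(2W^2-J_1W)S\approx 2W(2W-J_1)g=I_1g$
(`exists_commutator_entry_bound`). On the support $x\gtrsim R$, so the error is $O(x^{2s}/R)$. For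
the upper bound only the second difference of $g$, of size $x^{2s-2}$, enters, whence $R^{-2}$
(`exists_cutMult_average_le`). The remainders are multiples of $\langle D\rangle^{2s}$. -/

theorem average_exp_int (m : ℤ) :
    (1 / (2 * Real.pi) : ℂ) *
      ∫ x in (0 : ℝ)..(2 * Real.pi), Complex.exp (Complex.I * m * (x : ℂ)) =
        if m = 0 then 1 else 0 := by
  have hpi : (Real.pi : ℂ) ≠ 0 := Complex.ofReal_ne_zero.2 Real.pi_ne_zero
  split_ifs with h
  · subst h
    simp
    field_simp
  · have hm : Complex.I * (m : ℂ) ≠ 0 := mul_ne_zero Complex.I_ne_zero (Int.cast_ne_zero.2 h)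
    rw [integral_exp_mul_complex hm]
    have h1 : Complex.I * (m : ℂ) * ((2 * Real.pi : ℝ) : ℂ) = m * (2 * Real.pi * Complex.I) := by
      push_cast; ring
    rw [h1, Complex.exp_int_mul_two_pi_mul_I]
    simp

theorem symbolCoeff_trig {a : ℝ → ℝ → ℂ} {ξ : ℝ} {c₀ c₁ c₂ : ℂ}
    (h : ∀ x : ℝ, a x ξ = c₀ + c₁ * Complex.exp (Complex.I * 2 * x) +
      c₂ * Complex.exp (-(Complex.I * 2 * x))) (n : ℤ) :
    symbolCoeff a n ξ =
      c₀ * (if n = 0 then 1 else 0) + c₁ * (if n = 2 then 1 else 0) +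
        c₂ * (if n = -2 then 1 else 0) := by
  have h1 : ∀ x : ℝ, a x ξ * Complex.exp (-(Complex.I * (n : ℂ) * (x : ℂ))) =
      c₀ * Complex.exp (Complex.I * ((-n : ℤ) : ℂ) * x) +
      c₁ * Complex.exp (Complex.I * ((2 - n : ℤ) : ℂ) * x) +
      c₂ * Complex.exp (Complex.I * ((-2 - n : ℤ) : ℂ) * x) := by
    intro x
    rw [h, add_mul, add_mul, mul_assoc c₁, mul_assoc c₂, ← Complex.exp_add, ← Complex.exp_add]
    push_cast
    ring_nf
  have hi : ∀ (c : ℂ) (m : ℤ), IntervalIntegrable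
      (fun x : ℝ => c * Complex.exp (Complex.I * (m : ℂ) * x)) MeasureTheory.volume
      0 (2 * Real.pi) := fun c m => by
    apply Continuous.intervalIntegrable
    fun_prop
  unfold symbolCoeff
  simp only [h1]
  rw [intervalIntegral.integral_add ((hi _ _).add (hi _ _)) (hi _ _),
    intervalIntegral.integral_add (hi _ _) (hi _ _)]
  simp only [intervalIntegral.integral_const_mul]
  have e0 : (-n = 0) ↔ n = 0 := by omega
  have e1 : (2 - n = 0) ↔ n = 2 := by omega
  have e2 : (-2 - n = 0) ↔ n = -2 := by omega
  have a0 := average_exp_int (-n)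
  have a1 := average_exp_int (2 - n)
  have a2 := average_exp_int (-2 - n)
  simp only [e0] at a0
  simp only [e1] at a1
  simp only [e2] at a2
  rw [← a0, ← a1, ← a2]
  ring

theorem bracket_pos (ξ : ℝ) : 0 < bracket ξ := lt_of_lt_of_le one_pos (le_max_left _ _)

theorem one_le_bracket (ξ : ℝ) : 1 ≤ bracket ξ := le_max_left _ _

theorem IsCutoff.zero_left {δ₀ : ℝ} {χ : ℝ → ℝ → ℝ} (hχ : IsCutoff δ₀ χ) (ξ : ℝ) : χ 0 ξ = 1 := by
  apply hχ.eq_one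
  have := mul_pos hχ.delta_pos (bracket_pos ξ)
  simp only [abs_zero]
  linarith

/-- With frequencies $0,\pm2$ the Weyl midpoints $(k+j)/2$ are the integers $k$, $k\mp1$, so symbol
and cut-off are sampled at integers only. -/
theorem OpBW_trig {δ₀ : ℝ} {χ : ℝ → ℝ → ℝ} (hχ : IsCutoff δ₀ χ) {a : ℝ → ℝ → ℂ} {c₀ c₁ c₂ : ℝ → ℂ}
    (h : ∀ x ξ : ℝ, a x ξ = c₀ ξ + c₁ ξ * Complex.exp (Complex.I * 2 * x) +
      c₂ ξ * Complex.exp (-(Complex.I * 2 * x))) (u : ℤ → ℂ) (k : ℤ) :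
    OpBW χ a u k = c₀ (k : ℤ) * u k +
      (χ 2 (k - 1 : ℤ) : ℂ) * c₁ (k - 1 : ℤ) * u (k - 2) +
      (χ 2 (k + 1 : ℤ) : ℂ) * c₂ (k + 1 : ℤ) * u (k + 2) := by
  unfold OpBW
  simp only [fun n ξ => symbolCoeff_trig (fun x => h x ξ) n]
  rw [tsum_eq_sum (s := {k, k - 2, k + 2})]
  · rw [Finset.sum_insert (by simp; omega), Finset.sum_insert (by simp; omega), Finset.sum_singleton]
    have e1 : ((k : ℝ) + ((k - 2 : ℤ) : ℝ)) / 2 = ((k - 1 : ℤ) : ℝ) := by push_cast; ring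
    have e2 : ((k : ℝ) + ((k + 2 : ℤ) : ℝ)) / 2 = ((k + 1 : ℤ) : ℝ) := by push_cast; ring
    have e3 : (k : ℝ) - ((k - 2 : ℤ) : ℝ) = 2 := by push_cast; ring
    have e4 : (k : ℝ) - ((k + 2 : ℤ) : ℝ) = -2 := by push_cast; ring
    have e5 : k - (k - 2) = 2 := by ring
    have e6 : k - (k + 2) = -2 := by ring
    rw [e1, e2, e3, e4, e5, e6, hχ.even_left]
    simp [hχ.zero_left]
    ring
  · intro j hj
    simp only [Finset.mem_insert, Finset.mem_singleton, not_or] at hj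
    rw [if_neg (by omega), if_neg (by omega), if_neg (by omega)]
    simp

/-! ## The operators of the Mourre estimate as banded matrices -/

/-- The multiplier `|ξ|^{2s} η_R(ξ)²`. -/
noncomputable def mult (s R ξ : ℝ) : ℝ := |ξ| ^ (2 * s) * etaR R ξ ^ 2

theorem OpBW_multSymbol {δ₀ : ℝ} {χ : ℝ → ℝ → ℝ} (hχ : IsCutoff δ₀ χ) (s R : ℝ) (u : ℤ → ℂ)
    (k : ℤ) : OpBW χ (multSymbol s R) u k = (mult s R k : ℂ) * u k := by
  rw [OpBW_trig hχ (c₀ := fun ξ => (mult s R ξ : ℂ)) (c₁ := 0) (c₂ := 0)]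
  · simp
  · intro x ξ
    simp [multSymbol, mult]

theorem ofReal_re_eq (z : ℂ) : ((z.re : ℝ) : ℂ) = (z + (starRingEnd ℂ) z) / 2 :=
  Complex.re_eq_add_conj z

theorem conj_exp_two (x : ℝ) : (starRingEnd ℂ) (Complex.exp (Complex.I * 2 * (x : ℂ))) =
    Complex.exp (-(Complex.I * 2 * (x : ℂ))) := by
  rw [← Complex.exp_conj]
  simp [map_ofNat]

theorem frakA_apply {δ₀ : ℝ} {χ : ℝ → ℝ → ℝ} (hχ : IsCutoff δ₀ χ) (z₁ z₂ : ℂ) (s R : ℝ)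
    (u : ℤ → ℂ) (k : ℤ) :
    frakA χ z₁ z₂ s R u k =
      Complex.I * (z₁ * (starRingEnd ℂ) z₂) / 2 *
        ((χ 2 (k - 1 : ℤ) * mult s R (k - 1 : ℤ) : ℝ) : ℂ) * u (k - 2) +
      -Complex.I * ((starRingEnd ℂ) z₁ * z₂) / 2 *
        ((χ 2 (k + 1 : ℤ) * mult s R (k + 1 : ℤ) : ℝ) : ℂ) * u (k + 2) := by
  unfold frakA
  rw [OpBW_trig hχ (c₀ := 0)
    (c₁ := fun ξ => Complex.I * (z₁ * (starRingEnd ℂ) z₂) / 2 * (mult s R ξ : ℂ))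
    (c₂ := fun ξ => -Complex.I * ((starRingEnd ℂ) z₁ * z₂) / 2 * (mult s R ξ : ℂ))]
  · push_cast
    simp only [Pi.zero_apply]
    ring
  · intro x ξ
    have h : ((mourreCoeff z₁ z₂ x : ℝ) : ℂ) =
        Complex.I * (z₁ * (starRingEnd ℂ) z₂) / 2 * Complex.exp (Complex.I * 2 * x) +
        -Complex.I * ((starRingEnd ℂ) z₁ * z₂) / 2 * Complex.exp (-(Complex.I * 2 * x)) := by
      unfold mourreCoeff
      push_cast
      rw [Complex.im_eq_sub_conj, map_mul, map_mul, Complex.conj_conj, conj_exp_two]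
      field_simp
      simp only [Complex.I_sq]
      ring
    have h2 : mourreSymbol z₁ z₂ s R x ξ = (mourreCoeff z₁ z₂ x : ℂ) * (mult s R ξ : ℂ) := by
      simp only [mourreSymbol, mult]
      push_cast
      ring
    rw [h2, h]
    simp only [Pi.zero_apply]
    ring

theorem OpBW_transportSymbol {δ₀ : ℝ} {χ : ℝ → ℝ → ℝ} (hχ : IsCutoff δ₀ χ) (z₁ z₂ : ℂ)
    (u : ℤ → ℂ) (k : ℤ) :
    OpBW χ (transportSymbol z₁ z₂) u k =
      (J₁ z₁ z₂ : ℂ) * (k : ℂ) * u k +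
      z₁ * (starRingEnd ℂ) z₂ * ((χ 2 (k - 1 : ℤ) * (k - 1 : ℤ) : ℝ) : ℂ) * u (k - 2) +
      (starRingEnd ℂ) z₁ * z₂ * ((χ 2 (k + 1 : ℤ) * (k + 1 : ℤ) : ℝ) : ℂ) * u (k + 2) := by
  rw [OpBW_trig hχ (c₀ := fun ξ => (J₁ z₁ z₂ : ℂ) * (ξ : ℂ))
    (c₁ := fun ξ => z₁ * (starRingEnd ℂ) z₂ * (ξ : ℂ))
    (c₂ := fun ξ => (starRingEnd ℂ) z₁ * z₂ * (ξ : ℂ))]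
  · push_cast
    ring
  · intro x ξ
    simp only [transportSymbol, frakV]
    push_cast
    rw [ofReal_re_eq, map_mul, map_mul, Complex.conj_conj, conj_exp_two]
    ring

/-- The diagonal part $Jk$ commuted with a shift by $2$ yields the bands $\pm2$; the shifts commuted
with each other yield the diagonal and the bands $\pm4$. Indices such as `k - 2 + 1` stay
unsimplified to show the midpoint form expected by `hasSum_band`. -/
theorem iComm_apply {A B : (ℤ → ℂ) → (ℤ → ℂ)} {w : ℂ} {J : ℝ} {p q : ℤ → ℝ}
    (hA : ∀ u k, A u k = Complex.I * w / 2 * (p (k - 1) : ℂ) * u (k - 2) +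
      -Complex.I * (starRingEnd ℂ) w / 2 * (p (k + 1) : ℂ) * u (k + 2))
    (hB : ∀ u k, B u k = (J : ℂ) * (k : ℂ) * u k + w * (q (k - 1) : ℂ) * u (k - 2) +
      (starRingEnd ℂ) w * (q (k + 1) : ℂ) * u (k + 2)) (u : ℤ → ℂ) (k : ℤ) :
    iComm A B u k =
      ((‖w‖ ^ 2 * (p (k + 1) * q (k + 1) - p (k - 1) * q (k - 1)) : ℝ) : ℂ) * u k +
      ((J * w * (p (k - 1) : ℂ)) * u (k - 2) +
        (starRingEnd ℂ) (J * w * (p (k + 1) : ℂ)) * u (k + 2)) +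
      (-(w ^ 2 / 2) * ((p (k - 2 + 1) * q (k - 2 - 1) - p (k - 2 - 1) * q (k - 2 + 1) : ℝ) : ℂ) *
          u (k - 4) +
        (starRingEnd ℂ) (-(w ^ 2 / 2) *
          ((p (k + 2 + 1) * q (k + 2 - 1) - p (k + 2 - 1) * q (k + 2 + 1) : ℝ) : ℂ)) *
          u (k + 4)) := by
  have hw : ((‖w‖ ^ 2 : ℝ) : ℂ) = w * (starRingEnd ℂ) w := by
    rw [Complex.mul_conj, Complex.normSq_eq_norm_sq]
  have e1 : k - 2 + 2 = k := by ring
  have e2 : k + 2 - 2 = k := by ring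
  have e3 : k - 2 - 2 = k - 4 := by ring
  have e4 : k + 2 + 2 = k + 4 := by ring
  have e5 : k - 2 - 1 = k - 3 := by ring
  have e6 : k + 2 + 1 = k + 3 := by ring
  have e7 : k - 2 + 1 = k - 1 := by ring
  have e8 : k + 2 - 1 = k + 1 := by ring
  simp only [iComm, Pi.smul_apply, Pi.sub_apply, smul_eq_mul]
  rw [hA, hB (A u)]
  simp only [hA u, hB u, e1, e2, e3, e4, e5, e6, e7, e8]
  simp only [Complex.ofReal_mul (‖w‖ ^ 2), hw]
  simp only [map_mul, map_neg, map_div₀, map_pow, Complex.conj_ofReal, map_ofNat]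
  push_cast
  ring_nf
  simp only [Complex.I_sq]
  ring

/-! ## Quadratic forms of banded matrices on smooth functions -/

/-- Sequences of at most polynomial growth. -/
def PolyBdd (f : ℤ → ℝ) : Prop := ∃ C r : ℝ, 0 ≤ C ∧ 0 ≤ r ∧ ∀ k : ℤ, |f k| ≤ C * bracket k ^ r

theorem bracket_add_le (k m : ℤ) : bracket ((k + m : ℤ) : ℝ) ≤ (1 + |(m : ℝ)|) * bracket k := by
  have h1 := one_le_bracket (k : ℝ)
  have h2 : |(k : ℝ)| ≤ bracket k := le_max_right _ _
  have h3 := abs_nonneg (m : ℝ)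
  apply max_le
  · nlinarith
  · push_cast
    calc |(k : ℝ) + m| ≤ |(k : ℝ)| + |(m : ℝ)| := abs_add_le _ _
      _ ≤ (1 + |(m : ℝ)|) * bracket k := by nlinarith

theorem PolyBdd.shift {f : ℤ → ℝ} (hf : PolyBdd f) (m : ℤ) : PolyBdd (fun k => f (k + m)) := by
  obtain ⟨C, r, hC, hr, h⟩ := hf
  refine ⟨C * (1 + |(m : ℝ)|) ^ r, r, by positivity, hr, fun k => (h _).trans ?_⟩
  rw [mul_assoc, ← Real.mul_rpow (by positivity) (bracket_pos _).le]
  gcongr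
  · exact (bracket_pos _).le
  · exact bracket_add_le k m

theorem PolyBdd.mul {f g : ℤ → ℝ} (hf : PolyBdd f) (hg : PolyBdd g) :
    PolyBdd (fun k => f k * g k) := by
  obtain ⟨C, r, hC, hr, h⟩ := hf
  obtain ⟨C', r', hC', hr', h'⟩ := hg
  refine ⟨C * C', r + r', by positivity, by positivity, fun k => ?_⟩
  rw [abs_mul, Real.rpow_add (bracket_pos _)]
  calc |f k| * |g k| ≤ (C * bracket k ^ r) * (C' * bracket k ^ r') :=
        mul_le_mul (h k) (h' k) (abs_nonneg _) ((abs_nonneg _).trans (h k))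
    _ = _ := by ring

theorem PolyBdd.add {f g : ℤ → ℝ} (hf : PolyBdd f) (hg : PolyBdd g) :
    PolyBdd (fun k => f k + g k) := by
  obtain ⟨C, r, hC, hr, h⟩ := hf
  obtain ⟨C', r', hC', hr', h'⟩ := hg
  refine ⟨C + C', r + r', by positivity, by positivity, fun k => ?_⟩
  have h1 : bracket k ^ r ≤ bracket k ^ (r + r') :=
    Real.rpow_le_rpow_of_exponent_le (one_le_bracket _) (by linarith)
  have h2 : bracket k ^ r' ≤ bracket k ^ (r + r') :=
    Real.rpow_le_rpow_of_exponent_le (one_le_bracket _) (by linarith)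
  calc |f k + g k| ≤ |f k| + |g k| := abs_add_le _ _
    _ ≤ C * bracket k ^ r + C' * bracket k ^ r' := add_le_add (h k) (h' k)
    _ ≤ C * bracket k ^ (r + r') + C' * bracket k ^ (r + r') := by gcongr
    _ = _ := by ring

theorem PolyBdd.of_abs_le {f g : ℤ → ℝ} (hg : PolyBdd g) (h : ∀ k, |f k| ≤ |g k|) :
    PolyBdd f := by
  obtain ⟨C, r, hC, hr, h'⟩ := hg
  exact ⟨C, r, hC, hr, fun k => (h k).trans (h' k)⟩

theorem polyBdd_const (c : ℝ) : PolyBdd (fun _ => c) :=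
  ⟨|c|, 0, abs_nonneg c, le_rfl, fun k => by simp⟩

theorem polyBdd_cast : PolyBdd (fun k : ℤ => (k : ℝ)) :=
  ⟨1, 1, zero_le_one, zero_le_one, fun k => by
    rw [one_mul, Real.rpow_one]; exact le_max_right _ _⟩

theorem PolyBdd.summable_mul_sq {f : ℤ → ℝ} (hf : PolyBdd f) (u : SobInf) :
    Summable fun k => f k * ‖u.1 k‖ ^ 2 := by
  obtain ⟨C, r, hC, hr, h⟩ := hf
  have hu : Summable fun k : ℤ => bracket k ^ (2 * (r / 2)) * ‖u.1 k‖ ^ 2 := u.2 (r / 2)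
  rw [mul_div_cancel₀ _ two_ne_zero] at hu
  refine Summable.of_norm_bounded (hu.mul_left C) fun k => ?_
  rw [norm_mul, Real.norm_eq_abs, norm_pow, norm_norm, ← mul_assoc]
  gcongr
  exact h k

theorem PolyBdd.summable_mul_sq_shift {f : ℤ → ℝ} (hf : PolyBdd f) (u : SobInf) (m : ℤ) :
    Summable fun k => f k * ‖u.1 (k + m)‖ ^ 2 := by
  have h := (hf.shift (-m)).summable_mul_sq u
  rw [← (Equiv.addRight m).summable_iff] at h
  refine h.congr fun k => ?_
  simp

theorem tsum_mul_sq_shift (f : ℤ → ℝ) (u : ℤ → ℂ) (m : ℤ) :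
    ∑' k, f k * ‖u (k + m)‖ ^ 2 = ∑' k, f (k - m) * ‖u k‖ ^ 2 := by
  rw [← (Equiv.addRight m).tsum_eq (fun k => f (k - m) * ‖u k‖ ^ 2)]
  simp

theorem hasSum_diagonal {d : ℤ → ℝ} (hd : PolyBdd d) (u : SobInf) :
    HasSum (fun k => (d k : ℂ) * u.1 k * (starRingEnd ℂ) (u.1 k))
      ((∑' k, d k * ‖u.1 k‖ ^ 2 : ℝ) : ℂ) := by
  have h := Complex.hasSum_ofReal.2 (hd.summable_mul_sq u).hasSum
  refine h.congr_fun fun k => ?_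
  rw [mul_assoc, Complex.mul_conj, Complex.normSq_eq_norm_sq]
  push_cast
  rfl

theorem hasSum_shift {X : ℤ → ℂ} {S : ℂ} (h : HasSum X S) (m : ℤ) :
    HasSum (fun k => X (k + m)) S :=
  (Equiv.addRight m).hasSum_iff.2 h

/-- With $\beta$ indexed by the midpoint, both bands come from one sequence
$X_k=\beta_ku_{k-m}\overline{u_{k+m}}$: the lower one is a translate of $X$, the upper one a
translate of $\overline X$. Their total is $2\,\mathrm{Re}\sum X$, and $2|ab|\le|a|^2+|b|^2$ gives
the bound. -/
theorem hasSum_band {β : ℤ → ℂ} (hβ : PolyBdd fun k => ‖β k‖) (u : SobInf) (m : ℤ) :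
    ∃ t : ℝ, HasSum (fun k => (β (k - m) * u.1 (k - 2 * m) +
        (starRingEnd ℂ) (β (k + m)) * u.1 (k + 2 * m)) * (starRingEnd ℂ) (u.1 k)) (t : ℂ) ∧
      |t| ≤ ∑' k, (‖β (k - m)‖ + ‖β (k + m)‖) * ‖u.1 k‖ ^ 2 := by
  set X : ℤ → ℂ := fun k => β k * u.1 (k - m) * (starRingEnd ℂ) (u.1 (k + m)) with hX
  have hs1 := hβ.summable_mul_sq_shift u (-m)
  have hs2 := hβ.summable_mul_sq_shift u m
  have hXb : ∀ k, ‖X k‖ ≤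
      (1 / 2) * (‖β k‖ * ‖u.1 (k + -m)‖ ^ 2 + ‖β k‖ * ‖u.1 (k + m)‖ ^ 2) := by
    intro k
    simp only [hX, norm_mul, RCLike.norm_conj, ← sub_eq_add_neg]
    nlinarith [mul_nonneg (norm_nonneg (β k)) (sq_nonneg (‖u.1 (k - m)‖ - ‖u.1 (k + m)‖))]
  have hXs : Summable X := Summable.of_norm_bounded ((hs1.add hs2).mul_left (1 / 2)) hXb
  obtain ⟨S, hS⟩ := hXs
  have h1 : HasSum (fun k => X (k - m)) S := hasSum_shift hS (-m)
  have h2 : HasSum (fun k => X (k + m)) S := hasSum_shift hS m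
  have h3 : HasSum (fun k => (starRingEnd ℂ) (X (k + m))) ((starRingEnd ℂ) S) := h2.star
  refine ⟨2 * S.re, ?_, ?_⟩
  · have h4 := h1.add h3
    rw [Complex.add_conj] at h4
    refine h4.congr_fun fun k => ?_
    simp only [hX, map_mul, Complex.conj_conj]
    rw [show k - m - m = k - 2 * m by ring, show k + m + m = k + 2 * m by ring,
      show k - m + m = k by ring, show k + m - m = k by ring]
    ring
  · have h5 : ‖S‖ ≤ (1 / 2) * (∑' k, ‖β k‖ * ‖u.1 (k + -m)‖ ^ 2 +
        ∑' k, ‖β k‖ * ‖u.1 (k + m)‖ ^ 2) := by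
      rw [← hs1.tsum_add hs2, ← tsum_mul_left]
      rw [← hS.tsum_eq]
      exact tsum_of_norm_bounded ((hs1.add hs2).mul_left (1 / 2)).hasSum hXb
    have h6 := Complex.abs_re_le_norm S
    rw [abs_mul, abs_two]
    have s1 : Summable fun k => ‖β (k - m)‖ * ‖u.1 k‖ ^ 2 := (hβ.shift (-m)).summable_mul_sq u
    have s2 : Summable fun k => ‖β (k + m)‖ * ‖u.1 k‖ ^ 2 := (hβ.shift m).summable_mul_sq u
    simp only [add_mul]
    rw [s1.tsum_add s2]
    rw [tsum_mul_sq_shift, tsum_mul_sq_shift] at h5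
    simp only [sub_neg_eq_add] at h5
    linarith

/-! ## Diagonal remainders -/

/-- The operator `c ⟨D⟩^{2s}` from `H^s` to `H^{-s}`. -/
noncomputable def bracketPow (s c : ℝ) : Sob s →ₗ[ℂ] Sob (-s) where
  toFun u := ⟨fun k => ((c * bracket k ^ (2 * s) : ℝ) : ℂ) * u.1 k, by
    have hu : Summable fun k : ℤ => bracket k ^ (2 * s) * ‖u.1 k‖ ^ 2 := u.2
    refine (hu.mul_left (c ^ 2)).congr fun k => ?_
    have hb := Real.rpow_pos_of_pos (bracket_pos k) (2 * s)
    rw [norm_mul, Complex.norm_real, mul_neg, Real.rpow_neg (bracket_pos _).le, mul_pow,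
      Real.norm_eq_abs, sq_abs]
    field_simp⟩
  map_add' u v := by
    ext k
    simp [mul_add]
  map_smul' a u := by
    ext k
    simp
    ring

/-- Since $\langle k\rangle^{-2s}\langle k\rangle^{4s}=\langle k\rangle^{2s}$, the operator norm of
the remainder is exactly $|c|$. -/
theorem sobNorm_bracketPow (s c : ℝ) (u : Sob s) :
    sobNorm (-s) (bracketPow s c u : ℤ → ℂ) = |c| * sobNorm s (u : ℤ → ℂ) := by
  unfold sobNorm
  rw [← Real.sqrt_sq_eq_abs, ← Real.sqrt_mul (sq_nonneg c), ← tsum_mul_left]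
  congr 2
  ext k
  have hb := Real.rpow_pos_of_pos (bracket_pos k) (2 * s)
  simp only [bracketPow, LinearMap.coe_mk, AddHom.coe_mk]
  rw [norm_mul, Complex.norm_real, mul_neg, Real.rpow_neg (bracket_pos _).le, mul_pow,
    Real.norm_eq_abs, sq_abs]
  field_simp

theorem polyBdd_bracket_rpow {r : ℝ} (hr : 0 ≤ r) : PolyBdd fun k : ℤ => bracket k ^ r :=
  ⟨1, r, zero_le_one, hr, fun k => by
    rw [one_mul, abs_of_nonneg (Real.rpow_nonneg (bracket_pos _).le _)]⟩

/-! ## Regularity of the multiplier -/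

theorem eta_eq_smoothTransition (y : ℝ) : eta y = Real.smoothTransition (y - 1) := by
  unfold eta
  split_ifs with h1 h2
  · rw [Real.smoothTransition.zero_of_nonpos (by linarith)]
  · have h3 : ¬ (y - 1 ≤ 0) := by linarith
    have h4 : ¬ (1 - (y - 1) ≤ 0) := by linarith
    simp only [Real.smoothTransition, expNegInvGlue, h3, h4, if_false, one_div]
    rw [show 1 - (y - 1) = 2 - y by ring]
  · rw [Real.smoothTransition.one_of_one_le (by linarith)]

/-- The square `η²` of the smooth step function. -/
noncomputable def etaSq (y : ℝ) : ℝ := Real.smoothTransition (y - 1) ^ 2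

theorem contDiff_etaSq : ContDiff ℝ 2 etaSq := by
  have h : ContDiff ℝ 2 Real.smoothTransition := Real.smoothTransition.contDiff (n := 2)
  exact (h.comp (contDiff_id.sub contDiff_const)).pow 2

theorem etaSq_nonneg (y : ℝ) : 0 ≤ etaSq y := sq_nonneg _

theorem etaSq_le_one (y : ℝ) : etaSq y ≤ 1 :=
  pow_le_one₀ (Real.smoothTransition.nonneg _) (Real.smoothTransition.le_one _)

theorem monotone_etaSq : Monotone etaSq := fun x y h =>
  pow_le_pow_left₀ (Real.smoothTransition.nonneg _)
    (Real.smoothTransition.monotone (by linarith)) 2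

theorem etaSq_of_le {y : ℝ} (h : y ≤ 1) : etaSq y = 0 := by
  simp [etaSq, Real.smoothTransition.zero_of_nonpos (show y - 1 ≤ 0 by linarith)]

theorem etaSq_of_ge {y : ℝ} (h : 2 ≤ y) : etaSq y = 1 := by
  simp [etaSq, Real.smoothTransition.one_of_one_le (show 1 ≤ y - 1 by linarith)]

theorem deriv_etaSq_eq_zero {y : ℝ} (h : y ∉ Set.Icc (1 : ℝ) 2) : deriv etaSq y = 0 := by
  rcases lt_or_ge y 1 with h1 | h1
  · have : etaSq =ᶠ[nhds y] fun _ => (0 : ℝ) := by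
      filter_upwards [Iio_mem_nhds h1] with z hz using etaSq_of_le hz.le
    rw [this.deriv_eq, deriv_const]
  · have h2 : 2 < y := by
      by_contra h2
      exact h ⟨h1, not_lt.1 h2⟩
    have : etaSq =ᶠ[nhds y] fun _ => (1 : ℝ) := by
      filter_upwards [Ioi_mem_nhds h2] with z hz using etaSq_of_ge hz.le
    rw [this.deriv_eq, deriv_const]

theorem deriv_deriv_etaSq_eq_zero {y : ℝ} (h : y ∉ Set.Icc (1 : ℝ) 2) :
    deriv (deriv etaSq) y = 0 := by
  have : deriv etaSq =ᶠ[nhds y] fun _ => (0 : ℝ) := by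
    filter_upwards [isClosed_Icc.isOpen_compl.mem_nhds h] with z hz using deriv_etaSq_eq_zero hz
  rw [this.deriv_eq, deriv_const]

theorem contDiff_deriv_etaSq : ContDiff ℝ 1 (deriv etaSq) :=
  (contDiff_succ_iff_deriv (n := 1).1 (by simpa [one_add_one_eq_two] using contDiff_etaSq)).2.2

/-- The derivatives live on $[1,2]$. The weights $y$, $y^2$ make these quantities invariant under
scaling, which gives bounds uniform in $R$ after $y=\xi/R$. -/
theorem exists_bound_deriv_etaSq : ∃ C : ℝ, 0 ≤ C ∧ ∀ y : ℝ,
    |y * deriv etaSq y| ≤ C ∧ |y ^ 2 * deriv (deriv etaSq) y| ≤ C := by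
  have c1 : Continuous (deriv etaSq) := contDiff_deriv_etaSq.continuous
  have c2 : Continuous (deriv (deriv etaSq)) := contDiff_deriv_etaSq.continuous_deriv le_rfl
  obtain ⟨C₁, h₁⟩ := (HasCompactSupport.intro (f := fun y => y * deriv etaSq y)
    (isCompact_Icc (a := (1 : ℝ)) (b := 2)) fun y hy => by
      simp [deriv_etaSq_eq_zero hy]).exists_bound_of_continuous (by fun_prop)
  obtain ⟨C₂, h₂⟩ := (HasCompactSupport.intro (f := fun y => y ^ 2 * deriv (deriv etaSq) y)
    (isCompact_Icc (a := (1 : ℝ)) (b := 2)) fun y hy => by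
      simp [deriv_deriv_etaSq_eq_zero hy]).exists_bound_of_continuous (by fun_prop)
  exact ⟨max C₁ C₂, ((norm_nonneg _).trans (h₁ 0)).trans (le_max_left _ _),
    fun y => ⟨(h₁ y).trans (le_max_left _ _), (h₂ y).trans (le_max_right _ _)⟩⟩

theorem mult_eq (s R ξ : ℝ) : mult s R ξ = |ξ| ^ (2 * s) * etaSq (ξ / R) := by
  simp [mult, etaR, eta_eq_smoothTransition, etaSq]

theorem mult_nonneg (s R ξ : ℝ) : 0 ≤ mult s R ξ := by
  unfold mult
  positivity

theorem mult_le (s R ξ : ℝ) : mult s R ξ ≤ |ξ| ^ (2 * s) := by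
  rw [mult_eq]
  exact mul_le_of_le_one_right (by positivity) (etaSq_le_one _)

/-- The argument of $\eta_R$ is signed, so all negative frequencies are removed as well. -/
theorem mult_of_le {s R ξ : ℝ} (hR : 0 < R) (h : ξ ≤ R) : mult s R ξ = 0 := by
  rw [mult_eq, etaSq_of_le ((div_le_one hR).2 h), mul_zero]

/-- `mult s R ξ / ξ` is nondecreasing for `ξ > 0`. -/
theorem mult_mul_le {s R x y : ℝ} (hs : 1 < s) (hR : 0 < R) (hx : 0 < x) (hxy : x ≤ y) :
    mult s R x * y ≤ mult s R y * x := by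
  have hy := hx.trans_le hxy
  -- Splitting off one factor $z$ leaves $z^{2s-1}\eta^2(z/R)$, a product of nonnegative
  -- nondecreasing functions.
  have e : ∀ z : ℝ, 0 < z → z ^ (2 * s) = z * z ^ (2 * s - 1) := fun z hz => by
    rw [← Real.rpow_one_add' hz.le (by linarith)]
    ring_nf
  rw [mult_eq, mult_eq, abs_of_pos hx, abs_of_pos hy, e x hx, e y hy]
  have h1 : x ^ (2 * s - 1) ≤ y ^ (2 * s - 1) := Real.rpow_le_rpow hx.le hxy (by linarith)
  have h2 : etaSq (x / R) ≤ etaSq (y / R) := monotone_etaSq (by gcongr)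
  have h3 : x ^ (2 * s - 1) * etaSq (x / R) ≤ y ^ (2 * s - 1) * etaSq (y / R) :=
    mul_le_mul h1 h2 (etaSq_nonneg _) (by positivity)
  calc _ = x * y * (x ^ (2 * s - 1) * etaSq (x / R)) := by ring
    _ ≤ x * y * (y ^ (2 * s - 1) * etaSq (y / R)) := by gcongr
    _ = _ := by ring

theorem exists_mult_deriv_bounds {s : ℝ} (hs : 1 < s) : ∃ C : ℝ, 0 ≤ C ∧ ∀ R : ℝ, 0 < R →
    ∃ g' g'' : ℝ → ℝ, ∀ ξ : ℝ, 0 < ξ → HasDerivAt (mult s R) (g' ξ) ξ ∧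
      HasDerivAt g' (g'' ξ) ξ ∧ |g' ξ| ≤ C * ξ ^ (2 * s - 1) ∧
      |g'' ξ| ≤ C * ξ ^ (2 * s - 2) := by
  obtain ⟨C, hC, hb⟩ := exists_bound_deriv_etaSq
  -- Sum of the bounds $2s+C$ for the first derivative and $2s(2s-1)+4sC+C$ for the second.
  refine ⟨2 * s + 2 * s * (2 * s - 1) + (4 * s + 1) * C, ?_, fun R hR => ?_⟩
  · have : 0 ≤ 2 * s - 1 := by linarith
    positivity
  have d0 : ∀ y, HasDerivAt etaSq (deriv etaSq y) y := fun y =>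
    (contDiff_etaSq.differentiable (by norm_num) y).hasDerivAt
  have d1 : ∀ y, HasDerivAt (deriv etaSq) (deriv (deriv etaSq) y) y := fun y =>
    (contDiff_deriv_etaSq.differentiable (by norm_num) y).hasDerivAt
  have dR : ∀ ξ : ℝ, HasDerivAt (fun ξ => ξ / R) (1 / R) ξ := fun ξ =>
    (hasDerivAt_id ξ).div_const R
  have dp : ∀ (r ξ : ℝ), 0 < ξ → HasDerivAt (fun ξ : ℝ => ξ ^ r) (r * ξ ^ (r - 1)) ξ :=
    fun r ξ h => Real.hasDerivAt_rpow_const (Or.inl h.ne')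
  refine ⟨fun ξ => 2 * s * ξ ^ (2 * s - 1) * etaSq (ξ / R) +
      ξ ^ (2 * s) * (deriv etaSq (ξ / R) * (1 / R)),
    fun ξ => 2 * s * ((2 * s - 1) * ξ ^ (2 * s - 1 - 1)) * etaSq (ξ / R) +
      2 * s * ξ ^ (2 * s - 1) * (deriv etaSq (ξ / R) * (1 / R)) +
      (2 * s * ξ ^ (2 * s - 1) * (deriv etaSq (ξ / R) * (1 / R)) +
      ξ ^ (2 * s) * (deriv (deriv etaSq) (ξ / R) * (1 / R) * (1 / R))),
    fun ξ hξ => ⟨?_, ?_, ?_, ?_⟩⟩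
  · have h := (dp (2 * s) ξ hξ).mul ((d0 (ξ / R)).comp ξ (dR ξ))
    refine h.congr_of_eventuallyEq ?_
    filter_upwards [Ioi_mem_nhds hξ] with y hy
    rw [mult_eq, abs_of_pos hy]
    rfl
  · exact (((dp (2 * s - 1) ξ hξ).const_mul (2 * s)).mul ((d0 (ξ / R)).comp ξ (dR ξ))).add
      ((dp (2 * s) ξ hξ).mul (((d1 (ξ / R)).comp ξ (dR ξ)).mul_const (1 / R)))
  all_goals
    obtain ⟨hb1, hb2⟩ := hb (ξ / R)
    have hT0 := etaSq_nonneg (ξ / R)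
    have hT1 := etaSq_le_one (ξ / R)
    have hT : |etaSq (ξ / R)| ≤ 1 := by rwa [abs_of_nonneg hT0]
    have hs1 : 0 < 2 * s - 1 := by linarith
    have e1 : ξ ^ (2 * s) = ξ ^ (2 * s - 1) * ξ := by
      rw [← Real.rpow_add_one hξ.ne']; ring_nf
    have e2 : ξ ^ (2 * s - 1) = ξ ^ (2 * s - 2) * ξ := by
      rw [← Real.rpow_add_one hξ.ne']; ring_nf
  · have hP : 0 < ξ ^ (2 * s - 1) := Real.rpow_pos_of_pos hξ _
    calc _ = |ξ ^ (2 * s - 1) * (2 * s * etaSq (ξ / R) + ξ / R * deriv etaSq (ξ / R))| := by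
          beta_reduce; rw [e1]; congr 1; ring
      _ = ξ ^ (2 * s - 1) * |2 * s * etaSq (ξ / R) + ξ / R * deriv etaSq (ξ / R)| := by
          rw [abs_mul, abs_of_pos hP]
      _ ≤ ξ ^ (2 * s - 1) * (2 * s * 1 + C) := by
          gcongr
          refine (abs_add_le _ _).trans (add_le_add ?_ hb1)
          rw [abs_mul, abs_of_pos (by linarith : 0 < 2 * s)]
          gcongr
      _ ≤ _ := by
          rw [mul_comm]
          refine mul_le_mul_of_nonneg_right ?_ hP.le
          nlinarith [mul_pos (by linarith : 0 < 2 * s) hs1, mul_nonneg (by linarith : 0 ≤ s) hC]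
  · have hP : 0 < ξ ^ (2 * s - 2) := Real.rpow_pos_of_pos hξ _
    calc _ = |ξ ^ (2 * s - 2) * (2 * s * (2 * s - 1) * etaSq (ξ / R) +
            4 * s * (ξ / R * deriv etaSq (ξ / R)) +
            (ξ / R) ^ 2 * deriv (deriv etaSq) (ξ / R))| := by
          beta_reduce; rw [e1, e2, show 2 * s - 1 - 1 = 2 * s - 2 by ring]; congr 1; ring
      _ = ξ ^ (2 * s - 2) * |2 * s * (2 * s - 1) * etaSq (ξ / R) +
            4 * s * (ξ / R * deriv etaSq (ξ / R)) +
            (ξ / R) ^ 2 * deriv (deriv etaSq) (ξ / R)| := by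
          rw [abs_mul, abs_of_pos hP]
      _ ≤ ξ ^ (2 * s - 2) * (2 * s * (2 * s - 1) * 1 + 4 * s * C + C) := by
          gcongr
          refine (abs_add_le _ _).trans (add_le_add ((abs_add_le _ _).trans
            (add_le_add ?_ ?_)) hb2)
          · rw [abs_mul, abs_of_pos (by positivity : 0 < 2 * s * (2 * s - 1))]
            gcongr
          · rw [abs_mul, abs_of_pos (by linarith : 0 < 4 * s)]
            gcongr
      _ ≤ _ := by
          rw [mul_comm]
          refine mul_le_mul_of_nonneg_right ?_ hP.le
          linarith

/-! ## Finite differences -/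

theorem abs_sub_le_of_hasDerivAt {f f' : ℝ → ℝ} {a b M : ℝ}
    (h : ∀ y ∈ Set.Icc a b, HasDerivAt f (f' y) y) (hM : ∀ y ∈ Set.Icc a b, |f' y| ≤ M)
    {x y : ℝ} (hx : x ∈ Set.Icc a b) (hy : y ∈ Set.Icc a b) : |f y - f x| ≤ M * |y - x| :=
  (convex_Icc a b).norm_image_sub_le_of_norm_hasDerivWithin_le
    (fun z hz => (h z hz).hasDerivWithinAt) hM hx hy

/-- Mean value theorem on $[0,1]$ for $t\mapsto g(x+t)+g(x-t)$, whose derivative $g'(x+t)-g'(x-t)$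
is at most $2tM$. -/
theorem second_difference_le {g g' g'' : ℝ → ℝ} {x M : ℝ}
    (h : ∀ y ∈ Set.Icc (x - 3) (x + 3), HasDerivAt g (g' y) y)
    (h' : ∀ y ∈ Set.Icc (x - 3) (x + 3), HasDerivAt g' (g'' y) y)
    (hM : ∀ y ∈ Set.Icc (x - 3) (x + 3), |g'' y| ≤ M) :
    |g (x + 1) + g (x - 1) - 2 * g x| ≤ 2 * M := by
  have hM0 : 0 ≤ M := (abs_nonneg _).trans (hM x ⟨by linarith, by linarith⟩)
  have key := abs_sub_le_of_hasDerivAt (f := fun t => g (x + t) + g (x - t))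
    (f' := fun t => g' (x + t) + g' (x - t) * (-1)) (a := 0) (b := 1) (M := 2 * M)
    (fun t ht => ?_) (fun t ht => ?_) (x := 0) (y := 1) (by simp) (by simp)
  · simp only [add_zero, sub_zero, abs_one, mul_one] at key
    rwa [show g (x + 1) + g (x - 1) - 2 * g x = g (x + 1) + g (x - 1) - (g x + g x) by ring]
  · exact ((h _ ⟨by linarith [ht.1], by linarith [ht.2]⟩).comp_const_add x t).add
      ((h (x - t) ⟨by linarith [ht.2], by linarith [ht.1]⟩).comp t
        ((hasDerivAt_id t).const_sub x))
  · have h1 := abs_sub_le_of_hasDerivAt h' hM (x := x - t) (y := x + t)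
      ⟨by linarith [ht.2], by linarith [ht.1]⟩ ⟨by linarith [ht.1], by linarith [ht.2]⟩
    rw [show g' (x + t) + g' (x - t) * (-1) = g' (x + t) - g' (x - t) by ring]
    refine h1.trans ?_
    rw [show x + t - (x - t) = 2 * t by ring, abs_of_nonneg (by linarith [ht.1])]
    nlinarith [ht.2]

/-- The coefficient `g(x + 1)(x - 1) - g(x - 1)(x + 1)` of the commutator, which approximates
`2 (x g'(x) - g(x))`. -/
def crossDiff (g : ℝ → ℝ) (x : ℝ) : ℝ := g (x + 1) * (x - 1) - g (x - 1) * (x + 1)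

/-- The derivative of `crossDiff g` is $t(g'(t+1)-g'(t-1))-(g'(t+1)+g'(t-1))+(g(t+1)-g(t-1))$,
bounded by $4xM_2+2M_1+2M_1$; the distance $|y-x|\le2$ doubles this. The radius $3$ is this distance
plus the unit step. -/
theorem crossDiff_sub_le {g g' g'' : ℝ → ℝ} {x M₁ M₂ : ℝ} (hx : 3 ≤ x)
    (h : ∀ y ∈ Set.Icc (x - 3) (x + 3), HasDerivAt g (g' y) y)
    (h' : ∀ y ∈ Set.Icc (x - 3) (x + 3), HasDerivAt g' (g'' y) y)
    (hM₁ : ∀ y ∈ Set.Icc (x - 3) (x + 3), |g' y| ≤ M₁)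
    (hM₂ : ∀ y ∈ Set.Icc (x - 3) (x + 3), |g'' y| ≤ M₂)
    {y : ℝ} (hy : y ∈ Set.Icc (x - 2) (x + 2)) :
    |crossDiff g y - crossDiff g x| ≤ 8 * (x * M₂ + M₁) := by
  have hM0 : 0 ≤ M₂ := (abs_nonneg _).trans (hM₂ x ⟨by linarith, by linarith⟩)
  have hM1 : 0 ≤ M₁ := (abs_nonneg _).trans (hM₁ x ⟨by linarith, by linarith⟩)
  have key := abs_sub_le_of_hasDerivAt (f := crossDiff g)
    (f' := fun t => (g' (t + 1) * (t - 1) + g (t + 1) * 1) -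
      (g' (t - 1) * (t + 1) + g (t - 1) * 1)) (a := x - 2) (b := x + 2)
    (M := 4 * (x * M₂ + M₁)) (fun t ht => ?_) (fun t ht => ?_)
    (x := x) (y := y) ⟨by linarith, by linarith⟩ hy
  · refine key.trans ?_
    have h2 : |y - x| ≤ 2 := abs_le.2 ⟨by linarith [hy.1], by linarith [hy.2]⟩
    have h3 : 0 ≤ x * M₂ + M₁ := by nlinarith
    nlinarith
  · exact (((h (t + 1) ⟨by linarith [ht.1], by linarith [ht.2]⟩).comp_add_const t 1).mul
      ((hasDerivAt_id t).sub_const 1)).sub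
      (((h (t - 1) ⟨by linarith [ht.1], by linarith [ht.2]⟩).comp_sub_const t 1).mul
      ((hasDerivAt_id t).add_const 1))
  · have m1 : t + 1 ∈ Set.Icc (x - 3) (x + 3) := ⟨by linarith [ht.1], by linarith [ht.2]⟩
    have m2 : t - 1 ∈ Set.Icc (x - 3) (x + 3) := ⟨by linarith [ht.1], by linarith [ht.2]⟩
    have k1 := abs_sub_le_of_hasDerivAt h hM₁ m2 m1
    have k2 := abs_sub_le_of_hasDerivAt h' hM₂ m2 m1
    have k3 := hM₁ _ m1
    have k4 := hM₁ _ m2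
    rw [show t + 1 - (t - 1) = 2 by ring, abs_two] at k1 k2
    have ht0 : 0 ≤ t := by linarith [ht.1]
    have ht2 : t ≤ 2 * x := by linarith [ht.2]
    have k5 : |t * (g' (t + 1) - g' (t - 1))| ≤ 2 * x * (M₂ * 2) := by
      rw [abs_mul, abs_of_nonneg ht0]
      exact mul_le_mul ht2 k2 (abs_nonneg _) (by linarith)
    rw [abs_le] at k1 k3 k4 k5 ⊢
    constructor <;> nlinarith [k1.1, k1.2, k3.1, k3.2, k4.1, k4.2, k5.1, k5.2]

theorem exists_mult_difference_bounds {s : ℝ} (hs : 1 < s) : ∃ C : ℝ, 0 ≤ C ∧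
    ∀ R x : ℝ, 0 < R → 10 ≤ x →
      |mult s R (x + 1) + mult s R (x - 1) - 2 * mult s R x| ≤ C * x ^ (2 * s - 2) ∧
      ∀ y ∈ Set.Icc (x - 2) (x + 2),
        |crossDiff (mult s R) y - crossDiff (mult s R) x| ≤ C * x ^ (2 * s - 1) := by
  obtain ⟨C, hC, H⟩ := exists_mult_deriv_bounds hs
  -- For $x\ge10$ the window $[x-3,x+3]$ lies in $(0,2x]$, so moving powers to $x$ costs at most
  -- $2^{2s}$; $16$ is $8$ for each of the two terms of `crossDiff_sub_le`.
  refine ⟨16 * (C * 2 ^ (2 * s)), by positivity, fun R x hR hx => ?_⟩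
  obtain ⟨g', g'', hg⟩ := H R hR
  have hpos : ∀ y ∈ Set.Icc (x - 3) (x + 3), 0 < y := fun y hy => by linarith [hy.1]
  have hpow : ∀ r : ℝ, 0 ≤ r → r ≤ 2 * s → ∀ y ∈ Set.Icc (x - 3) (x + 3),
      C * y ^ r ≤ C * 2 ^ (2 * s) * x ^ r := by
    intro r hr hr' y hy
    have h1 : y ^ r ≤ (2 * x) ^ r :=
      Real.rpow_le_rpow (hpos y hy).le (by linarith [hy.2]) hr
    rw [Real.mul_rpow (by norm_num) (by linarith)] at h1
    have h2 : (2 : ℝ) ^ r ≤ 2 ^ (2 * s) := Real.rpow_le_rpow_of_exponent_le one_le_two hr'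
    have h3 : 0 ≤ x ^ r := Real.rpow_nonneg (by linarith) r
    rw [mul_assoc]
    gcongr
    exact h1.trans (mul_le_mul_of_nonneg_right h2 h3)
  have b1 : ∀ y ∈ Set.Icc (x - 3) (x + 3), |g' y| ≤ C * 2 ^ (2 * s) * x ^ (2 * s - 1) :=
    fun y hy => (hg y (hpos y hy)).2.2.1.trans
      (hpow _ (by linarith) (by linarith) y hy)
  have b2 : ∀ y ∈ Set.Icc (x - 3) (x + 3), |g'' y| ≤ C * 2 ^ (2 * s) * x ^ (2 * s - 2) :=
    fun y hy => (hg y (hpos y hy)).2.2.2.trans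
      (hpow _ (by linarith) (by linarith) y hy)
  have hxp : 0 < x := by linarith
  have e2 : x ^ (2 * s - 1) = x * x ^ (2 * s - 2) := by
    rw [mul_comm x, ← Real.rpow_add_one hxp.ne']; ring_nf
  constructor
  · refine (second_difference_le (fun y hy => (hg y (hpos y hy)).1)
      (fun y hy => (hg y (hpos y hy)).2.1) b2).trans ?_
    have : 0 ≤ C * 2 ^ (2 * s) * x ^ (2 * s - 2) := by positivity
    linarith
  · intro y hy
    refine (crossDiff_sub_le (by linarith) (fun y hy => (hg y (hpos y hy)).1)
      (fun y hy => (hg y (hpos y hy)).2.1) b1 b2 hy).trans (le_of_eq ?_)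
    rw [e2]
    ring

/-- This sign lets the bands $\pm4$ cancel against the diagonal instead of adding to the loss. -/
theorem crossDiff_mult_nonneg {s R x : ℝ} (hs : 1 < s) (hR : 0 < R) (hx : 1 < x) :
    0 ≤ crossDiff (mult s R) x :=
  sub_nonneg.2 (mult_mul_le hs hR (by linarith) (by linarith))

/-! ## Pointwise bounds for the matrix entries -/

theorem IsCutoff.exists_bound {δ₀ : ℝ} {χ : ℝ → ℝ → ℝ} (hχ : IsCutoff δ₀ χ) :
    ∃ M : ℝ, 0 ≤ M ∧ ∀ ξ' ξ : ℝ, |χ ξ' ξ| ≤ M := by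
  obtain ⟨C, hC⟩ := hχ.deriv_bound 0 0
  simp only [iteratedDeriv_zero, Nat.cast_zero, add_zero, neg_zero, Real.rpow_zero,
    mul_one] at hC
  exact ⟨C, (abs_nonneg _).trans (hC 0 0), hC⟩

theorem IsCutoff.eq_one_of_le {δ₀ : ℝ} {χ : ℝ → ℝ → ℝ} (hχ : IsCutoff δ₀ χ) {ξ : ℝ}
    (h : 4 / δ₀ ≤ ξ) : χ 2 ξ = 1 := by
  apply hχ.eq_one
  have h1 : ξ ≤ bracket ξ := (le_abs_self ξ).trans (le_max_right _ _)
  have h2 := (div_le_iff₀' hχ.delta_pos).1 (h.trans h1)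
  rw [abs_two]
  linarith

/-- The multiplier of the off-diagonal entries of `𝔄`. -/
noncomputable def cutMult (χ : ℝ → ℝ → ℝ) (s R ξ : ℝ) : ℝ := χ 2 ξ * mult s R ξ

/-- The multiplier of the off-diagonal entries of the transport operator. -/
noncomputable def cutId (χ : ℝ → ℝ → ℝ) (ξ : ℝ) : ℝ := χ 2 ξ * ξ

theorem cutMult_of_le {χ : ℝ → ℝ → ℝ} {s R ξ : ℝ} (hR : 0 < R) (h : ξ ≤ R) :
    cutMult χ s R ξ = 0 := by
  rw [cutMult, mult_of_le hR h, mul_zero]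

theorem abs_cutMult_le {χ : ℝ → ℝ → ℝ} {s R ξ M L : ℝ} (hs : 0 < s) (hM : ∀ ξ' ξ, |χ ξ' ξ| ≤ M)
    (h : |ξ| ≤ L) : |cutMult χ s R ξ| ≤ M * L ^ (2 * s) := by
  rw [cutMult, abs_mul, abs_of_nonneg (mult_nonneg _ _ _)]
  exact mul_le_mul (hM _ _) ((mult_le _ _ _).trans
    (Real.rpow_le_rpow (abs_nonneg _) h (by linarith))) (mult_nonneg _ _ _)
    ((abs_nonneg _).trans (hM 0 0))

theorem abs_cutId_le {χ : ℝ → ℝ → ℝ} {ξ M L : ℝ} (hM : ∀ ξ' ξ, |χ ξ' ξ| ≤ M)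
    (h : |ξ| ≤ L) : |cutId χ ξ| ≤ M * L := by
  rw [cutId, abs_mul]
  exact mul_le_mul (hM _ _) h (abs_nonneg _) ((abs_nonneg _).trans (hM 0 0))

theorem one_le_bracket_rpow {s : ℝ} (hs : 0 ≤ s) (ξ : ℝ) : 1 ≤ bracket ξ ^ (2 * s) :=
  Real.one_le_rpow (one_le_bracket ξ) (by linarith)

theorem exists_cutMult_average_le {δ₀ : ℝ} {χ : ℝ → ℝ → ℝ} (hχ : IsCutoff δ₀ χ) {s : ℝ}
    (hs : 1 < s) : ∃ C : ℝ, 0 ≤ C ∧ ∀ R x : ℝ, 1 < R →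
      (|cutMult χ s R (x - 1)| + |cutMult χ s R (x + 1)|) / 2 ≤
        2 * mult s R x + C / R ^ 2 * bracket x ^ (2 * s) := by
  obtain ⟨M, hM0, hM⟩ := hχ.exists_bound
  obtain ⟨C, hC, hd⟩ := exists_mult_difference_bounds hs
  have hδ : 0 < 4 / δ₀ := div_pos four_pos hχ.delta_pos
  -- If the entries do not vanish ($R<x+3$) and the cut-off may act ($x<4/\delta_0+10$), then $R<L$
  -- and $|x\pm1|\le L$: bounded quantities absorb the factor $R^{-2}$.
  set L : ℝ := 4 / δ₀ + 13 with hL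
  refine ⟨4 * C + M * L ^ (2 * s) * L ^ 2, by positivity, fun R x hR => ?_⟩
  have hR0 : 0 < R := by linarith
  have hb := one_le_bracket_rpow (by linarith : 0 ≤ s) x
  have hg := mult_nonneg s R x
  by_cases h1 : x + 3 ≤ R
  · rw [cutMult_of_le hR0 (by linarith), cutMult_of_le hR0 (by linarith)]
    simp only [abs_zero, add_zero, zero_div]
    positivity
  rw [not_le] at h1
  by_cases h2 : 4 / δ₀ + 10 ≤ x
  · have hx : 10 ≤ x := by linarith
    have hx0 : 0 < x := by linarith
    have hbx : bracket x = x := by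
      rw [bracket, abs_of_pos hx0, max_eq_right (by linarith)]
    simp only [cutMult]
    rw [hχ.eq_one_of_le (show 4 / δ₀ ≤ x - 1 by linarith),
      hχ.eq_one_of_le (show 4 / δ₀ ≤ x + 1 by linarith), one_mul, one_mul,
      abs_of_nonneg (mult_nonneg _ _ _), abs_of_nonneg (mult_nonneg _ _ _), hbx]
    have h3 := (abs_le.1 (hd R x hR0 hx).1).2
    have e : x ^ (2 * s) = x ^ (2 * s - 2) * x ^ 2 := by
      rw [← Real.rpow_add_natCast hx0.ne']; norm_num
    have h4 : C * x ^ (2 * s - 2) ≤ 4 * C / R ^ 2 * x ^ (2 * s) := by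
      rw [e, div_mul_eq_mul_div, le_div_iff₀ (by positivity)]
      have : R ^ 2 ≤ 4 * x ^ 2 := by nlinarith
      calc C * x ^ (2 * s - 2) * R ^ 2 ≤ C * x ^ (2 * s - 2) * (4 * x ^ 2) := by gcongr
        _ = _ := by ring
    have h5 : 4 * C / R ^ 2 * x ^ (2 * s) ≤
        (4 * C + M * L ^ (2 * s) * L ^ 2) / R ^ 2 * x ^ (2 * s) := by
      gcongr
      have : 0 ≤ M * L ^ (2 * s) * L ^ 2 := by positivity
      linarith
    have h6 : 0 ≤ C * x ^ (2 * s - 2) := by positivity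
    -- The second difference bounds the average by $g(x)$ plus the error; the coefficient $2$ in the
    -- statement leaves room.
    linarith
  · rw [not_le] at h2
    have k1 := abs_cutMult_le (R := R) (s := s) (by linarith) hM
      (show |x - 1| ≤ L from abs_le.2 ⟨by linarith, by linarith⟩)
    have k2 := abs_cutMult_le (R := R) (s := s) (by linarith) hM
      (show |x + 1| ≤ L from abs_le.2 ⟨by linarith, by linarith⟩)
    have h3 : M * L ^ (2 * s) ≤ (4 * C + M * L ^ (2 * s) * L ^ 2) / R ^ 2 := by
      rw [le_div_iff₀ (by positivity)]
      have : R ^ 2 ≤ L ^ 2 := by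
        have : R ≤ L := by linarith
        gcongr
      have h4 : M * L ^ (2 * s) * R ^ 2 ≤ M * L ^ (2 * s) * L ^ 2 := by gcongr
      linarith
    have h4 : M * L ^ (2 * s) ≤
        (4 * C + M * L ^ (2 * s) * L ^ 2) / R ^ 2 * bracket x ^ (2 * s) :=
      h3.trans (le_mul_of_one_le_right (by positivity) hb)
    linarith

/-- The entry `(x + 2, x - 2)` of the commutator, up to a factor. -/
noncomputable def cutCross (χ : ℝ → ℝ → ℝ) (s R x : ℝ) : ℝ :=
  cutMult χ s R (x + 1) * cutId χ (x - 1) - cutMult χ s R (x - 1) * cutId χ (x + 1)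

theorem cutCross_of_le {χ : ℝ → ℝ → ℝ} {s R x : ℝ} (hR : 0 < R) (h : x + 1 ≤ R) :
    cutCross χ s R x = 0 := by
  rw [cutCross, cutMult_of_le hR h, cutMult_of_le hR (by linarith)]
  ring

theorem cutCross_eq {δ₀ : ℝ} {χ : ℝ → ℝ → ℝ} (hχ : IsCutoff δ₀ χ) {s R x : ℝ}
    (h : 4 / δ₀ ≤ x - 1) : cutCross χ s R x = crossDiff (mult s R) x := by
  simp only [cutCross, cutMult, cutId, crossDiff]
  rw [hχ.eq_one_of_le h, hχ.eq_one_of_le (by linarith)]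
  ring

theorem abs_mul_le_of_abs_le {a b A B : ℝ} (ha : |a| ≤ A) (hb : |b| ≤ B) : |a * b| ≤ A * B := by
  rw [abs_mul]
  exact mul_le_mul ha hb (abs_nonneg _) ((abs_nonneg _).trans ha)

/-- Diagonal dominance at one frequency, with $W=|z_1||z_{-1}|$ and $J=J_1$. Three regimes: below
$R-3$ every entry vanishes; at high frequency the cut-off is $1$ and finite differences apply;
otherwise $x$ and $R$ are both bounded by $L$. -/
theorem exists_commutator_entry_bound {δ₀ : ℝ} {χ : ℝ → ℝ → ℝ} (hχ : IsCutoff δ₀ χ) {s : ℝ}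
    (hs : 1 < s) : ∃ C : ℝ, 0 ≤ C ∧ ∀ R x W J : ℝ, 1 < R → 0 ≤ W → W ≤ J →
      2 * W * (2 * W - J) * mult s R x - C * J ^ 2 / R * bracket x ^ (2 * s) ≤
        W ^ 2 * (cutMult χ s R (x + 1) * cutId χ (x + 1) -
          cutMult χ s R (x - 1) * cutId χ (x - 1)) -
        W ^ 2 / 2 * (|cutCross χ s R (x - 2)| + |cutCross χ s R (x + 2)|) -
        J * W * (|cutMult χ s R (x - 1)| + |cutMult χ s R (x + 1)|) := by
  obtain ⟨M, hM0, hM⟩ := hχ.exists_bound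
  obtain ⟨C, hC, hd⟩ := exists_mult_difference_bounds hs
  have hδ : 0 < 4 / δ₀ := div_pos four_pos hχ.delta_pos
  set L : ℝ := 4 / δ₀ + 13 with hL
  set P : ℝ := M * L ^ (2 * s) with hP
  set Q : ℝ := M * L with hQ
  have hP0 : 0 ≤ P := by positivity
  have hQ0 : 0 ≤ Q := by positivity
  -- High frequencies lose $3J^2\varepsilon$, and $R\le2x$ turns this into $6C$. The bracket bounds
  -- the entries and the main term in the bounded regime, the factor $L\ge R$ paying for the
  -- division by $R$.
  refine ⟨6 * C + (4 * (P * Q) + 2 * P + 2 * L ^ (2 * s)) * L, by positivity,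
    fun R x W J hR hW hWJ => ?_⟩
  have hR0 : 0 < R := by linarith
  have hJ : 0 ≤ J := hW.trans hWJ
  have hb := one_le_bracket_rpow (by linarith : 0 ≤ s) x
  have hWW : W ^ 2 ≤ J ^ 2 := by gcongr
  have hJW : J * W ≤ J ^ 2 := by nlinarith
  by_cases h1 : x + 3 ≤ R
  · rw [cutMult_of_le hR0 (by linarith), cutMult_of_le hR0 (by linarith),
      cutCross_of_le hR0 (by linarith), cutCross_of_le hR0 (by linarith),
      mult_of_le hR0 (by linarith)]
    simp only [abs_zero]
    have : 0 ≤ (6 * C + (4 * (P * Q) + 2 * P + 2 * L ^ (2 * s)) * L) * J ^ 2 / R *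
      bracket x ^ (2 * s) := by positivity
    linarith
  rw [not_le] at h1
  by_cases h2 : 4 / δ₀ + 10 ≤ x
  · have hx : 10 ≤ x := by linarith
    have hx0 : 0 < x := by linarith
    have hbx : bracket x = x := by
      rw [bracket, abs_of_pos hx0, max_eq_right (by linarith)]
    rw [cutCross_eq hχ (by linarith), cutCross_eq hχ (by linarith),
      abs_of_nonneg (crossDiff_mult_nonneg hs hR0 (by linarith)),
      abs_of_nonneg (crossDiff_mult_nonneg hs hR0 (by linarith))]
    simp only [cutMult, cutId]
    rw [hχ.eq_one_of_le (show 4 / δ₀ ≤ x - 1 by linarith),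
      hχ.eq_one_of_le (show 4 / δ₀ ≤ x + 1 by linarith), one_mul, one_mul, one_mul, one_mul,
      abs_of_nonneg (mult_nonneg _ _ _), abs_of_nonneg (mult_nonneg _ _ _), hbx]
    obtain ⟨d1, d2⟩ := hd R x hR0 hx
    have d3 := (abs_le.1 (d2 (x - 2) ⟨by linarith, by linarith⟩)).2
    have d4 := (abs_le.1 (d2 (x + 2) ⟨by linarith, by linarith⟩)).2
    -- This exhibits in the diagonal the copy of $D$ that compensates the bands $\pm4$.
    have hD : mult s R (x + 1) * (x + 1) - mult s R (x - 1) * (x - 1) =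
        crossDiff (mult s R) x + 2 * (mult s R (x + 1) + mult s R (x - 1)) := by
      unfold crossDiff; ring
    rw [hD]
    have e : x ^ (2 * s - 1) = x ^ (2 * s - 2) * x := by
      rw [← Real.rpow_add_one hx0.ne']; ring_nf
    have e' : x ^ (2 * s) = x ^ (2 * s - 1) * x := by
      rw [← Real.rpow_add_one hx0.ne']; ring_nf
    set ε : ℝ := C * x ^ (2 * s - 1) with hε
    have hε0 : 0 ≤ ε := by positivity
    have d5 : C * x ^ (2 * s - 2) ≤ ε := by
      rw [hε, e]
      have : x ^ (2 * s - 2) ≤ x ^ (2 * s - 2) * x :=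
        le_mul_of_one_le_right (by positivity) (by linarith)
      gcongr
    set D := crossDiff (mult s R) x
    set D₁ := crossDiff (mult s R) (x - 2)
    set D₂ := crossDiff (mult s R) (x + 2)
    set S := mult s R (x + 1) + mult s R (x - 1) with hS
    have d6 : |S - 2 * mult s R x| ≤ ε := d1.trans d5
    have k1 : W ^ 2 * ((D₁ + D₂) / 2 - D) ≤ J ^ 2 * ε :=
      (mul_le_mul_of_nonneg_left (by linarith) (sq_nonneg W)).trans
        (mul_le_mul_of_nonneg_right hWW hε0)
    -- The coefficient of $S$ has no fixed sign, so replacing $S$ by $2g$ requires the two-sided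
    -- bound `d6`.
    have k2 : |2 * W ^ 2 - J * W| ≤ 2 * J ^ 2 :=
      abs_le.2 ⟨by nlinarith [sq_nonneg W], by nlinarith [mul_nonneg hJ hW]⟩
    have k3 := (abs_le.1 (abs_mul_le_of_abs_le k2 d6)).1
    have k4 : 3 * (J ^ 2 * ε) ≤ 6 * C * J ^ 2 / R * x ^ (2 * s) := by
      rw [hε, e', div_mul_eq_mul_div, le_div_iff₀ hR0]
      calc 3 * (J ^ 2 * (C * x ^ (2 * s - 1))) * R
          ≤ 3 * (J ^ 2 * (C * x ^ (2 * s - 1))) * (2 * x) := by gcongr; linarith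
        _ = _ := by ring
    have k5 : 6 * C * J ^ 2 / R * x ^ (2 * s) ≤
        (6 * C + (4 * (P * Q) + 2 * P + 2 * L ^ (2 * s)) * L) * J ^ 2 / R * x ^ (2 * s) := by
      gcongr
      have : 0 ≤ (4 * (P * Q) + 2 * P + 2 * L ^ (2 * s)) * L := by positivity
      linarith
    linarith
  · rw [not_le] at h2
    have hp : ∀ y, |y| ≤ L → |cutMult χ s R y| ≤ P := fun y hy =>
      abs_cutMult_le (by linarith) hM hy
    have hq : ∀ y, |y| ≤ L → |cutId χ y| ≤ Q := fun y hy => abs_cutId_le hM hy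
    have hcross : ∀ y, |y + 1| ≤ L → |y - 1| ≤ L → |cutCross χ s R y| ≤ 2 * (P * Q) := by
      intro y h3 h4
      refine (abs_sub _ _).trans ?_
      have h5 := abs_mul_le_of_abs_le (hp _ h3) (hq _ h4)
      have h6 := abs_mul_le_of_abs_le (hp _ h4) (hq _ h3)
      linarith
    have i0 : |x| ≤ L := abs_le.2 ⟨by linarith, by linarith⟩
    have i1 : |x + 1| ≤ L := abs_le.2 ⟨by linarith, by linarith⟩
    have i2 : |x - 1| ≤ L := abs_le.2 ⟨by linarith, by linarith⟩
    have c1 := hcross (x - 2) (abs_le.2 ⟨by linarith, by linarith⟩)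
      (abs_le.2 ⟨by linarith, by linarith⟩)
    have c2 := hcross (x + 2) (abs_le.2 ⟨by linarith, by linarith⟩)
      (abs_le.2 ⟨by linarith, by linarith⟩)
    have c3 := (abs_le.1 (abs_mul_le_of_abs_le (hp _ i1) (hq _ i1))).1
    have c4 := (abs_le.1 (abs_mul_le_of_abs_le (hp _ i2) (hq _ i2))).2
    have c5 := hp _ i1
    have c6 := hp _ i2
    have g0 := mult_nonneg s R x
    have g1 : mult s R x ≤ L ^ (2 * s) :=
      (mult_le _ _ _).trans (Real.rpow_le_rpow (abs_nonneg _) i0 (by linarith))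
    have hPQ : 0 ≤ P * Q := by positivity
    have b1 : W ^ 2 * (-(2 * (P * Q))) ≤ W ^ 2 * (cutMult χ s R (x + 1) * cutId χ (x + 1) -
          cutMult χ s R (x - 1) * cutId χ (x - 1)) :=
      mul_le_mul_of_nonneg_left (by linarith) (sq_nonneg W)
    have b2 : W ^ 2 / 2 * (|cutCross χ s R (x - 2)| + |cutCross χ s R (x + 2)|) ≤
        W ^ 2 / 2 * (4 * (P * Q)) :=
      mul_le_mul_of_nonneg_left (by linarith) (by positivity)
    have b3 : J * W * (|cutMult χ s R (x - 1)| + |cutMult χ s R (x + 1)|) ≤ J ^ 2 * (2 * P) :=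
      mul_le_mul hJW (by linarith) (by positivity) (by positivity)
    have b4 : 2 * W * (2 * W - J) * mult s R x ≤ 2 * J ^ 2 * L ^ (2 * s) :=
      mul_le_mul (by nlinarith) g1 g0 (by positivity)
    have b5 : W ^ 2 * (4 * (P * Q)) ≤ J ^ 2 * (4 * (P * Q)) :=
      mul_le_mul_of_nonneg_right hWW (by linarith)
    have b6 : J ^ 2 * (4 * (P * Q) + 2 * P + 2 * L ^ (2 * s)) ≤
        (6 * C + (4 * (P * Q) + 2 * P + 2 * L ^ (2 * s)) * L) * J ^ 2 / R := by
      rw [le_div_iff₀ hR0]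
      have hRL : R ≤ L := by linarith
      calc J ^ 2 * (4 * (P * Q) + 2 * P + 2 * L ^ (2 * s)) * R
          ≤ J ^ 2 * (4 * (P * Q) + 2 * P + 2 * L ^ (2 * s)) * L := by gcongr
        _ ≤ J ^ 2 * (4 * (P * Q) + 2 * P + 2 * L ^ (2 * s)) * L + 6 * C * J ^ 2 :=
          le_add_of_nonneg_right (by positivity)
        _ = _ := by ring
    have b7 : (6 * C + (4 * (P * Q) + 2 * P + 2 * L ^ (2 * s)) * L) * J ^ 2 / R ≤
        (6 * C + (4 * (P * Q) + 2 * P + 2 * L ^ (2 * s)) * L) * J ^ 2 / R *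
          bracket x ^ (2 * s) :=
      le_mul_of_one_le_right (by positivity) hb
    linarith

/-! ## The operator inequalities -/

theorem polyBdd_mult {s : ℝ} (hs : 0 < s) (R : ℝ) : PolyBdd fun k : ℤ => mult s R k :=
  (polyBdd_bracket_rpow (r := 2 * s) (by linarith)).of_abs_le fun k => by
    rw [abs_of_nonneg (mult_nonneg _ _ _),
      abs_of_nonneg (Real.rpow_nonneg (bracket_pos _).le _)]
    exact (mult_le _ _ _).trans
      (Real.rpow_le_rpow (abs_nonneg _) (le_max_right _ _) (by linarith))

theorem IsCutoff.polyBdd {δ₀ : ℝ} {χ : ℝ → ℝ → ℝ} (hχ : IsCutoff δ₀ χ) :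
    PolyBdd fun k : ℤ => χ 2 k := by
  obtain ⟨M, hM0, hM⟩ := hχ.exists_bound
  exact (polyBdd_const M).of_abs_le fun k => (hM _ _).trans (le_abs_self M)

theorem polyBdd_cutMult {δ₀ : ℝ} {χ : ℝ → ℝ → ℝ} (hχ : IsCutoff δ₀ χ) {s : ℝ} (hs : 0 < s)
    (R : ℝ) : PolyBdd fun k : ℤ => cutMult χ s R k :=
  hχ.polyBdd.mul (polyBdd_mult hs R)

theorem polyBdd_cutId {δ₀ : ℝ} {χ : ℝ → ℝ → ℝ} (hχ : IsCutoff δ₀ χ) :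
    PolyBdd fun k : ℤ => cutId χ k :=
  hχ.polyBdd.mul polyBdd_cast

theorem PolyBdd.const_mul {f : ℤ → ℝ} (hf : PolyBdd f) (c : ℝ) : PolyBdd fun k => c * f k :=
  (polyBdd_const c).mul hf

theorem PolyBdd.sub {f g : ℤ → ℝ} (hf : PolyBdd f) (hg : PolyBdd g) :
    PolyBdd fun k => f k - g k := by
  simpa [sub_eq_add_neg] using hf.add (hg.const_mul (-1))

theorem PolyBdd.norm_mul_ofReal {f : ℤ → ℝ} (hf : PolyBdd f) (c : ℂ) :
    PolyBdd fun k => ‖c * (f k : ℂ)‖ :=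
  (hf.const_mul ‖c‖).of_abs_le fun k => by simp

/-- An inequality between the quadratic forms of a diagonal operator and of a banded one follows
from the diagonal dominance of the difference. -/
theorem tsum_mul_sq_le_add {d d' r₁ r₂ : ℤ → ℝ} {t₁ t₂ : ℝ} (u : SobInf) (hd : PolyBdd d)
    (hd' : PolyBdd d') (hr₁ : PolyBdd r₁) (hr₂ : PolyBdd r₂)
    (h₁ : |t₁| ≤ ∑' k, r₁ k * ‖u.1 k‖ ^ 2) (h₂ : |t₂| ≤ ∑' k, r₂ k * ‖u.1 k‖ ^ 2)
    (h : ∀ k, d k ≤ d' k - r₁ k - r₂ k) :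
    ∑' k, d k * ‖u.1 k‖ ^ 2 ≤ ∑' k, d' k * ‖u.1 k‖ ^ 2 + t₁ + t₂ := by
  have hs := hd.summable_mul_sq u
  have hs' := hd'.summable_mul_sq u
  have hs₁ := hr₁.summable_mul_sq u
  have hs₂ := hr₂.summable_mul_sq u
  have h3 : ∑' k, d k * ‖u.1 k‖ ^ 2 ≤
      ∑' k, (d' k * ‖u.1 k‖ ^ 2 - r₁ k * ‖u.1 k‖ ^ 2 - r₂ k * ‖u.1 k‖ ^ 2) :=
    hs.tsum_le_tsum (fun k => by
      rw [← sub_mul, ← sub_mul]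
      exact mul_le_mul_of_nonneg_right (h k) (sq_nonneg _)) ((hs'.sub hs₁).sub hs₂)
  rw [(hs'.sub hs₁).tsum_sub hs₂, hs'.tsum_sub hs₁] at h3
  linarith [(abs_le.1 h₁).1, (abs_le.1 h₂).1]

theorem pairing_diagonal {A : ℤ → ℂ} {d : ℤ → ℝ} (hd : PolyBdd d) (u : SobInf)
    (h : ∀ k, A k = (d k : ℂ) * u.1 k) :
    pairing A u.1 = ((∑' k, d k * ‖u.1 k‖ ^ 2 : ℝ) : ℂ) := by
  unfold pairing
  simp only [h]
  exact (hasSum_diagonal hd u).tsum_eq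

theorem opLE_frakA {δ₀ : ℝ} {χ : ℝ → ℝ → ℝ} (hχ : IsCutoff δ₀ χ) {s : ℝ} (hs : 0 < s) (R : ℝ)
    (z₁ z₂ : ℂ) (c : ℝ)
    (h : ∀ k : ℤ, ‖z₁‖ * ‖z₂‖ / 2 * (|cutMult χ s R (k - 1)| + |cutMult χ s R (k + 1)|) ≤
      2 * ‖z₁‖ * ‖z₂‖ * mult s R k + c * bracket k ^ (2 * s)) :
    OpLE (fun u => frakA χ z₁ z₂ s R u.1)
      (fun u => ((2 * ‖z₁‖ * ‖z₂‖ : ℝ) : ℂ) • OpBW χ (multSymbol s R) u.1 +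
        (bracketPow s c ⟨u.1, u.2 s⟩ : ℤ → ℂ)) := by
  intro u
  set β : ℤ → ℂ := fun k =>
    Complex.I * (z₁ * (starRingEnd ℂ) z₂) / 2 * ((cutMult χ s R k : ℝ) : ℂ) with hβ
  have pβ : PolyBdd fun k => ‖β k‖ := (polyBdd_cutMult hχ hs R).norm_mul_ofReal _
  have hd : PolyBdd fun k : ℤ => 2 * ‖z₁‖ * ‖z₂‖ * mult s R k + c * bracket k ^ (2 * s) :=
    ((polyBdd_mult hs R).const_mul _).add
      ((polyBdd_bracket_rpow (by linarith : 0 ≤ 2 * s)).const_mul c)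
  have hB := pairing_diagonal (A := ((2 * ‖z₁‖ * ‖z₂‖ : ℝ) : ℂ) • OpBW χ (multSymbol s R) u.1 +
        (bracketPow s c ⟨u.1, u.2 s⟩ : ℤ → ℂ)) hd u (fun k => by
    simp only [Pi.add_apply, Pi.smul_apply, OpBW_multSymbol hχ, smul_eq_mul, bracketPow,
      LinearMap.coe_mk, AddHom.coe_mk]
    push_cast
    ring)
  obtain ⟨t, ht, htb⟩ := hasSum_band pβ u 1
  have hA : pairing (frakA χ z₁ z₂ s R u.1) u.1 = (t : ℂ) := by
    refine (tsum_congr fun k => ?_).trans ht.tsum_eq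
    rw [frakA_apply hχ]
    simp only [hβ, cutMult, map_mul, map_div₀, Complex.conj_I, Complex.conj_conj,
      Complex.conj_ofReal, map_ofNat, mul_one]
  have hr : PolyBdd fun k => ‖β (k - 1)‖ + ‖β (k + 1)‖ := (pβ.shift (-1)).add (pβ.shift 1)
  -- The upper bound is the positivity of right side minus $\mathfrak A$, hence the sign of `t` and
  -- the zero lower diagonal.
  have key := tsum_mul_sq_le_add (t₁ := -t) (t₂ := 0) (d := 0) (r₂ := 0) u
    (polyBdd_const 0) hd hr (polyBdd_const 0) (by rwa [abs_neg]) (by simp) (fun k => by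
      have hn : ∀ j, ‖β j‖ = ‖z₁‖ * ‖z₂‖ / 2 * |cutMult χ s R j| := fun j => by
        simp [hβ]
      simp only [Pi.zero_apply, hn]
      push_cast
      linarith [h k])
  beta_reduce
  rw [hA, hB]
  simp only [Complex.ofReal_im, Complex.ofReal_re, true_and]
  simp only [Pi.zero_apply, zero_mul, tsum_zero] at key
  linarith

/-- Hypothesis `h` says that the diagonal beats the row sums of the bands $\pm2$ and $\pm4$ at each
frequency; summing against $|u_k|^2$ gives the operator inequality. -/
theorem opLE_iComm {δ₀ : ℝ} {χ : ℝ → ℝ → ℝ} (hχ : IsCutoff δ₀ χ) {s : ℝ} (hs : 0 < s) (R : ℝ)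
    (z₁ z₂ : ℂ) (I c : ℝ)
    (h : ∀ k : ℤ, I * mult s R k - c * bracket k ^ (2 * s) ≤
      (‖z₁‖ * ‖z₂‖) ^ 2 * (cutMult χ s R (k + 1) * cutId χ (k + 1) -
          cutMult χ s R (k - 1) * cutId χ (k - 1)) -
        (‖z₁‖ * ‖z₂‖) ^ 2 / 2 * (|cutCross χ s R (k - 2)| + |cutCross χ s R (k + 2)|) -
        J₁ z₁ z₂ * (‖z₁‖ * ‖z₂‖) * (|cutMult χ s R (k - 1)| + |cutMult χ s R (k + 1)|)) :
    OpLE (fun u => (I : ℂ) • OpBW χ (multSymbol s R) u.1 +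
        (bracketPow s (-c) ⟨u.1, u.2 s⟩ : ℤ → ℂ))
      (fun u => iComm (frakA χ z₁ z₂ s R) (OpBW χ (transportSymbol z₁ z₂)) u.1) := by
  intro u
  set w : ℂ := z₁ * (starRingEnd ℂ) z₂ with hw
  have hwn : ‖w‖ = ‖z₁‖ * ‖z₂‖ := by simp [hw]
  have hwc : (starRingEnd ℂ) w = (starRingEnd ℂ) z₁ * z₂ := by simp [hw]
  set p : ℤ → ℝ := fun k => cutMult χ s R k with hp
  set q : ℤ → ℝ := fun k => cutId χ k with hq
  have pp : PolyBdd p := polyBdd_cutMult hχ hs R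
  have pq : PolyBdd q := polyBdd_cutId hχ
  have hcomm := iComm_apply (A := frakA χ z₁ z₂ s R) (B := OpBW χ (transportSymbol z₁ z₂))
    (w := w) (J := J₁ z₁ z₂) (p := p) (q := q)
    (fun u k => by rw [frakA_apply hχ, hwc]; rfl)
    (fun u k => by rw [OpBW_transportSymbol hχ, hwc]; rfl) u.1
  set b : ℤ → ℂ := fun k => J₁ z₁ z₂ * w * (p k : ℂ) with hb
  set e : ℤ → ℂ := fun k =>
    -(w ^ 2 / 2) * ((p (k + 1) * q (k - 1) - p (k - 1) * q (k + 1) : ℝ) : ℂ) with he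
  have pb : PolyBdd fun k => ‖b k‖ := pp.norm_mul_ofReal _
  have pe : PolyBdd fun k => ‖e k‖ :=
    (((pp.shift 1).mul (pq.shift (-1))).sub ((pp.shift (-1)).mul (pq.shift 1))).norm_mul_ofReal _
  have pd : PolyBdd fun k : ℤ =>
      ‖w‖ ^ 2 * (p (k + 1) * q (k + 1) - p (k - 1) * q (k - 1)) :=
    (((pp.shift 1).mul (pq.shift 1)).sub ((pp.shift (-1)).mul (pq.shift (-1)))).const_mul _
  obtain ⟨t₁, ht₁, hb₁⟩ := hasSum_band pb u 1
  obtain ⟨t₂, ht₂, hb₂⟩ := hasSum_band pe u 2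
  have hB : pairing (iComm (frakA χ z₁ z₂ s R) (OpBW χ (transportSymbol z₁ z₂)) u.1) u.1 =
      ((∑' k, ‖w‖ ^ 2 * (p (k + 1) * q (k + 1) - p (k - 1) * q (k - 1)) * ‖u.1 k‖ ^ 2 + t₁ + t₂ :
        ℝ) : ℂ) := by
    rw [Complex.ofReal_add, Complex.ofReal_add]
    refine (tsum_congr fun k => ?_).trans (((hasSum_diagonal pd u).add ht₁).add ht₂).tsum_eq
    rw [hcomm k, add_mul, add_mul]
    rfl
  have hd : PolyBdd fun k : ℤ => I * mult s R k - c * bracket k ^ (2 * s) :=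
    ((polyBdd_mult hs R).const_mul _).sub
      ((polyBdd_bracket_rpow (by linarith : 0 ≤ 2 * s)).const_mul c)
  have hA := pairing_diagonal (A := (I : ℂ) • OpBW χ (multSymbol s R) u.1 +
        (bracketPow s (-c) ⟨u.1, u.2 s⟩ : ℤ → ℂ)) hd u (fun k => by
    simp only [Pi.add_apply, Pi.smul_apply, OpBW_multSymbol hχ, smul_eq_mul, bracketPow,
      LinearMap.coe_mk, AddHom.coe_mk]
    push_cast
    ring)
  have hJ : 0 ≤ J₁ z₁ z₂ := by unfold J₁; positivity
  have key := tsum_mul_sq_le_add u hd pd ((pb.shift (-1)).add (pb.shift 1))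
    ((pe.shift (-2)).add (pe.shift 2)) hb₁ hb₂ (fun k => by
      have hn₁ : ∀ j, ‖b j‖ = J₁ z₁ z₂ * (‖z₁‖ * ‖z₂‖) * |cutMult χ s R j| := fun j => by
        simp only [hb, norm_mul, Complex.norm_real, hwn, Real.norm_eq_abs, abs_of_nonneg hJ, hp]
      have hn₂ : ∀ j : ℤ, ‖e j‖ = (‖z₁‖ * ‖z₂‖) ^ 2 / 2 * |cutCross χ s R j| := fun j => by
        simp only [he, norm_mul, norm_neg, norm_div, norm_pow, Complex.norm_real, hwn,
          Real.norm_eq_abs, hp, hq, cutCross, RCLike.norm_ofNat]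
        push_cast
        rfl
      simp only [hn₁, hn₂, hp, hq, hwn]
      push_cast
      have := h k
      simp only [← sub_eq_add_neg]
      linarith)
  beta_reduce
  rw [hA, hB]
  simp only [Complex.ofReal_im, Complex.ofReal_re, true_and]
  exact key

/-- Since $\mathfrak v\ge-2W$, a negative value forces $2W>J_1\ge0$, and $I_1=2W(2W-J_1)$. -/
theorem I₁_pos_of_changes_sign {z₁ z₂ : ℂ} {x : ℝ} (h : J₁ z₁ z₂ + frakV z₁ z₂ x < 0) :
    0 < I₁ z₁ z₂ := by
  have hw := Complex.abs_re_le_norm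
    (z₁ * (starRingEnd ℂ) z₂ * Complex.exp (Complex.I * 2 * (x : ℂ)))
  have he : ‖Complex.exp (Complex.I * 2 * (x : ℂ))‖ = 1 := by
    rw [show Complex.I * 2 * (x : ℂ) = ((2 * x : ℝ) : ℂ) * Complex.I by push_cast; ring]
    exact Complex.norm_exp_ofReal_mul_I _
  rw [norm_mul, norm_mul, RCLike.norm_conj, he, mul_one] at hw
  have h1 := (abs_le.1 hw).1
  unfold frakV at h
  have h2 : J₁ z₁ z₂ < 2 * (‖z₁‖ * ‖z₂‖) := by linarith
  have hJ : 0 ≤ J₁ z₁ z₂ := by unfold J₁; positivity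
  unfold I₁
  unfold J₁ at h2 hJ
  apply mul_pos <;> linarith

end ParaMourre

theorem lemma6p2 (δ₀ : ℝ) (χ : ℝ → ℝ → ℝ) (hχ : IsCutoff δ₀ χ) (s : ℝ) (hs : 1 < s) :
    ∃ C : ℝ, 0 < C ∧ ∀ (R : ℝ), 1 < R → ∀ z₁ z₂ : ℂ,
      -- the constant of the commutator estimate is positive if the transport speed changes sign
      ((∃ x y : ℝ, J₁ z₁ z₂ + frakV z₁ z₂ x < 0 ∧ 0 < J₁ z₁ z₂ + frakV z₁ z₂ y) →
        0 < I₁ z₁ z₂) ∧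
      -- positive commutator
      (∃ Rem : Sob s →ₗ[ℂ] Sob (-s),
        OpLE
          (fun u => (I₁ z₁ z₂ : ℂ) • OpBW χ (multSymbol s R) u.1 +
            (Rem ⟨u.1, u.2 s⟩ : ℤ → ℂ))
          (fun u => iComm (frakA χ z₁ z₂ s R) (OpBW χ (transportSymbol z₁ z₂)) u.1) ∧
        ∀ u : Sob s, sobNorm (-s) (Rem u : ℤ → ℂ) ≤
          C * ((‖z₁‖ ^ 4 + ‖z₂‖ ^ 4) / R) * sobNorm s (u : ℤ → ℂ)) ∧
      -- upper bound
      (∃ Rem : Sob s →ₗ[ℂ] Sob (-s),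
        OpLE
          (fun u => frakA χ z₁ z₂ s R u.1)
          (fun u => ((2 * ‖z₁‖ * ‖z₂‖ : ℝ) : ℂ) • OpBW χ (multSymbol s R) u.1 +
            (Rem ⟨u.1, u.2 s⟩ : ℤ → ℂ)) ∧
        ∀ u : Sob s, sobNorm (-s) (Rem u : ℤ → ℂ) ≤
          C * ((‖z₁‖ ^ 2 + ‖z₂‖ ^ 2) / R ^ 2) * sobNorm s (u : ℤ → ℂ)) := by
  have hs0 : 0 < s := by linarith
  obtain ⟨C₁, hC₁, H₁⟩ := exists_commutator_entry_bound hχ hs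
  obtain ⟨C₂, hC₂, H₂⟩ := exists_cutMult_average_le hχ hs
  -- One constant serves both estimates; the $1$ makes it strictly positive.
  refine ⟨C₁ + C₂ + 1, by positivity, fun R hR z₁ z₂ => ⟨?_, ?_, ?_⟩⟩
  · rintro ⟨x, _, hx, _⟩
    exact I₁_pos_of_changes_sign hx
  · have hR0 : 0 < R := by linarith
    refine ⟨bracketPow s (-((C₁ + C₂ + 1) * ((‖z₁‖ ^ 4 + ‖z₂‖ ^ 4) / R))),
      opLE_iComm hχ hs0 R z₁ z₂ (I₁ z₁ z₂) _ fun k => ?_, fun u => ?_⟩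
    · have hWJ : ‖z₁‖ * ‖z₂‖ ≤ J₁ z₁ z₂ := by
        unfold J₁
        nlinarith [sq_nonneg (‖z₁‖ - ‖z₂‖)]
      have h1 := H₁ R k (‖z₁‖ * ‖z₂‖) (J₁ z₁ z₂) hR (by positivity) hWJ
      have h2 : J₁ z₁ z₂ ^ 2 ≤ ‖z₁‖ ^ 4 + ‖z₂‖ ^ 4 := by
        unfold J₁
        nlinarith [sq_nonneg (‖z₁‖ ^ 2 - ‖z₂‖ ^ 2), sq_nonneg (‖z₁‖ ^ 2), sq_nonneg (‖z₂‖ ^ 2)]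
      have h3 : C₁ * J₁ z₁ z₂ ^ 2 / R * bracket k ^ (2 * s) ≤
          (C₁ + C₂ + 1) * ((‖z₁‖ ^ 4 + ‖z₂‖ ^ 4) / R) * bracket k ^ (2 * s) := by
        have := Real.rpow_nonneg (bracket_pos k).le (2 * s)
        rw [mul_div_assoc]
        gcongr
        linarith
      have h4 : I₁ z₁ z₂ =
          2 * (‖z₁‖ * ‖z₂‖) * (2 * (‖z₁‖ * ‖z₂‖) - J₁ z₁ z₂) := by
        unfold I₁ J₁
        ring
      rw [h4]
      linarith
    · rw [sobNorm_bracketPow, abs_neg, abs_of_nonneg (by positivity)]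
  · have hR0 : 0 < R := by linarith
    refine ⟨bracketPow s ((C₁ + C₂ + 1) * ((‖z₁‖ ^ 2 + ‖z₂‖ ^ 2) / R ^ 2)),
      opLE_frakA hχ hs0 R z₁ z₂ _ fun k => ?_, fun u => ?_⟩
    · have h1 := mul_le_mul_of_nonneg_left (H₂ R k hR)
        (mul_nonneg (norm_nonneg z₁) (norm_nonneg z₂))
      have h2 : ‖z₁‖ * ‖z₂‖ ≤ ‖z₁‖ ^ 2 + ‖z₂‖ ^ 2 := by
        nlinarith [sq_nonneg (‖z₁‖ - ‖z₂‖), sq_nonneg ‖z₁‖, sq_nonneg ‖z₂‖]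
      have h3 : C₂ * ((‖z₁‖ * ‖z₂‖) / R ^ 2) * bracket k ^ (2 * s) ≤
          (C₁ + C₂ + 1) * ((‖z₁‖ ^ 2 + ‖z₂‖ ^ 2) / R ^ 2) * bracket k ^ (2 * s) := by
        have := Real.rpow_nonneg (bracket_pos k).le (2 * s)
        gcongr
        linarith
      have h4 : ‖z₁‖ * ‖z₂‖ * (C₂ / R ^ 2 * bracket k ^ (2 * s)) =
          C₂ * ((‖z₁‖ * ‖z₂‖) / R ^ 2) * bracket k ^ (2 * s) := by ring
      linarith
    · rw [sobNorm_bracketPow, abs_of_nonneg (by positivity)]
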